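/- Let $K$ be a field of characteristic $0$, complete with respect to a nontrivial non-archimedean norm. All series below are formal power series in one variable over $K$; such a series is called (locally) analytic if its radius of convergence at $0$ is positive, and $f$ is tangent to the identity if $f(x)=x+O(x^2)$. For $f$ tangent to the identity write $$Z_F(f)=\{g\in K[[x]] : g(x)=x+O(x^2),\ g\circ f=f\circ g\},\qquad Z_A(f)=\{g\in Z_F(f) : g \text{ analytic}\}$$ for its formal and its analytic centralizer. Say that $f$ has invariants $m\ge 2$ and $\mu\in K$ if there is a formal power series $H$ over $K$ with $H(0)=0$, $H'(0)\ne 0$ and $H\circ f\circ H^{-1}(x)=x+x^m+\mu x^{2m-1}$. For a formal vector field $V(x)\frac{\partial}{\partial x}$ with $V(x)=O(x^2)$, its formal flow is the unique series $T_V^t(x)=\sum_{n\ge1}a_n(t)x^n$ with $a_n\in K[t]$ such that $T_V^0(x)=x$ and $\frac{d}{dt}T_V^t(x)=V(T_V^t(x))$. **Corollary (centralizers).** Let $f$ be analytic and tangent to the identity, with invariants $m$ and $\mu$, and let $$V=\frac{x^m}{1-\left(\mu-\frac m2\right)x^{m-1}}\,\frac{\partial}{\partial x}.$$ Then there is an analytic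 $h$ with $h(0)=0$, $h'(0)\neq0$ and $h\circ f\circ h^{-1}=T_V^1$; if the coefficient of $x^m$ in $f$ is $1$, then $h$ can be chosen tangent to the identity. Moreover, for every analytic $h$ with $h(0)=0$, $h'(0)\ne0$ and $h\circ f\circ h^{-1}=T_V^1$, $$Z_A(f)=\{h^{-1}\circ T_V^t\circ h : t\in K\}\qquad\text{and}\qquad Z_F(f)=Z_A(f).$$ -/

import Mathlib

open PowerSeries

namespace NonArchGerm

/-! ### Power series fixing the origin: composition, inversion, conjugation, convergence -/

section Basic

variable {K : Type*} [Field K]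

/-- Composition `f ∘ g` of formal power series (meaningful when `g` has no constant term). -/
noncomputable def comp (f g : K⟦X⟧) : K⟦X⟧ := f.subst g

/-- The compositional inverse of `h = a x + O(x ^ 2)` with `a ≠ 0`. -/
noncomputable def compInv (h : K⟦X⟧) (h1 : coeff 1 h ≠ 0) : K⟦X⟧ :=
  h.substInvOfIsUnit h1.isUnit

theorem comp_compInv (h : K⟦X⟧) (h0 : constantCoeff h = 0) (h1 : coeff 1 h ≠ 0) :
    comp h (compInv h h1) = X :=
  h.subst_substInvOfIsUnit_right h0 h1.isUnit

theorem compInv_comp (h : K⟦X⟧) (h0 : constantCoeff h = 0) (h1 : coeff 1 h ≠ 0) :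
    comp (compInv h h1) h = X :=
  h.subst_substInvOfIsUnit_left h0 h1.isUnit

/-- The conjugate `h ∘ f ∘ h⁻¹`. -/
noncomputable def conj (h : K⟦X⟧) (h1 : coeff 1 h ≠ 0) (f : K⟦X⟧) : K⟦X⟧ :=
  comp h (comp f (compInv h h1))

/-- `f(x) = x + O(x ^ 2)`. -/
def TangentToId (f : K⟦X⟧) : Prop :=
  constantCoeff f = 0 ∧ coeff 1 f = 1

/-- `f` has formal invariants `m` and `μ`: it is formally conjugate to
`x + x ^ m + μ x ^ (2 m - 1)`, where `2 ≤ m`. -/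
def HasInvariants (f : K⟦X⟧) (m : ℕ) (μ : K) : Prop :=
  2 ≤ m ∧ ∃ (H : K⟦X⟧) (H1 : coeff 1 H ≠ 0), constantCoeff H = 0 ∧
    conj H H1 f = X + X ^ m + C μ * X ^ (2 * m - 1)

/-- The formal centralizer of `f`, in the group of formal series tangent to the identity. -/
def formalCentralizer (f : K⟦X⟧) : Set K⟦X⟧ :=
  {g | TangentToId g ∧ comp g f = comp f g}

end Basic

/-- `f = ∑ aₙ xⁿ` is locally analytic at `0`: its radius of convergence is positive. -/
def IsLocallyAnalytic {K : Type*} [NontriviallyNormedField K] (f : K⟦X⟧) : Prop :=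
  0 < (FormalMultilinearSeries.ofScalars K (fun n => coeff n f)).radius

/-- The analytic centralizer of `f`, in the group of locally analytic series tangent to the
identity. -/
def analyticCentralizer {K : Type*} [NontriviallyNormedField K] (f : K⟦X⟧) : Set K⟦X⟧ :=
  {g | IsLocallyAnalytic g ∧ TangentToId g ∧ comp g f = comp f g}

/-! ### The formal flow of a vector field `V(x) ∂/∂x` with `V = O(x ^ 2)`

A vector field is given by its coefficient series `V`. Its flow is a series
`T = ∑ aₙ(t) xⁿ` whose coefficients are polynomials in the time `t`. -/

section Flow

variable {K : Type*} [Field K]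

/-- Differentiation with respect to the time, coefficient by coefficient. -/
noncomputable def timeDeriv (T : (Polynomial K)⟦X⟧) : (Polynomial K)⟦X⟧ :=
  PowerSeries.mk fun n => Polynomial.derivative (coeff n T)

/-- `T` is the formal flow of `V ∂/∂x`: it has no constant term, it is the identity at time `0`,
and `dT/dt = V(T)`. -/
def IsFormalFlow (V : K⟦X⟧) (T : (Polynomial K)⟦X⟧) : Prop :=
  constantCoeff T = 0 ∧ PowerSeries.map (Polynomial.evalRingHom 0) T = X ∧
    timeDeriv T = V.subst T

/-- The antiderivative of a polynomial that vanishes at `0`. -/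
noncomputable def antideriv (p : Polynomial K) : Polynomial K :=
  p.sum fun n a => Polynomial.monomial (n + 1) (a / ((n : K) + 1))

/-- The Picard operator `T ↦ x + ∫₀ᵗ V(T) dt`. -/
noncomputable def picard (V : K⟦X⟧) (T : (Polynomial K)⟦X⟧) : (Polynomial K)⟦X⟧ :=
  X + PowerSeries.mk fun n => antideriv (coeff n (V.subst T : (Polynomial K)⟦X⟧))

/-- The formal flow of `V ∂/∂x`, by formal antidifferentiation: the coefficient of `xⁿ` is stable
from the `n`-th Picard iterate on. See `isFormalFlow_flow` and `IsFormalFlow.eq_flow`. -/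
noncomputable def flow (V : K⟦X⟧) : (Polynomial K)⟦X⟧ :=
  PowerSeries.mk fun n => coeff n ((picard V)^[n] X)

/-- The time-`t` map of the formal flow of `V ∂/∂x`. -/
noncomputable def timeMap (V : K⟦X⟧) (t : K) : K⟦X⟧ :=
  PowerSeries.map (Polynomial.evalRingHom t) (flow V)

theorem hasSubst_of_dvd {T : (Polynomial K)⟦X⟧} (hT : X ∣ T) : HasSubst T :=
  HasSubst.of_constantCoeff_zero' (X_dvd_iff.mp hT)

theorem dvd_subst_sub {V : K⟦X⟧} (hV : X ^ 2 ∣ V) {S T : (Polynomial K)⟦X⟧} (hS : X ∣ S)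
    (hT : X ∣ T) {n : ℕ} (h : X ^ n ∣ S - T) :
    X ^ (n + 1) ∣ (V.subst S : (Polynomial K)⟦X⟧) - V.subst T := by
  rw [X_pow_dvd_iff]
  intro i hi
  rw [map_sub, coeff_subst' (hasSubst_of_dvd hS), coeff_subst' (hasSubst_of_dvd hT), sub_eq_zero]
  refine finsum_congr fun d => ?_
  by_cases hd : d < 2
  · rw [X_pow_dvd_iff.mp hV d hd, zero_smul, zero_smul]
  · have key : X ^ (n + 1) ∣ S ^ d - T ^ d := by
      rw [pow_succ, ← (Commute.all S T).mul_geom_sum₂ d]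
      refine mul_dvd_mul h (Finset.dvd_sum fun j hj => ?_)
      rw [Finset.mem_range] at hj
      by_cases hj0 : j = 0
      · exact Dvd.dvd.mul_left (dvd_pow hT (by omega)) _
      · exact Dvd.dvd.mul_right (dvd_pow hS hj0) _
    have := X_pow_dvd_iff.mp key i hi
    rw [map_sub, sub_eq_zero] at this
    rw [this]

theorem antideriv_zero : antideriv (0 : Polynomial K) = 0 := by
  simp [antideriv]

theorem eval_antideriv (p : Polynomial K) : (antideriv p).eval 0 = 0 := by
  simp [antideriv, Polynomial.sum, Polynomial.eval_finsetSum]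

theorem derivative_antideriv [CharZero K] (p : Polynomial K) :
    Polynomial.derivative (antideriv p) = p := by
  have h : ∀ n : ℕ, (n : K) + 1 ≠ 0 := fun n => by exact_mod_cast n.succ_ne_zero
  conv_rhs => rw [p.as_sum_support]
  simp [antideriv, Polynomial.sum, h]

theorem eq_of_derivative_eq [CharZero K] {p q : Polynomial K}
    (h : Polynomial.derivative p = Polynomial.derivative q) (h0 : p.eval 0 = q.eval 0) : p = q := by
  have hd : Polynomial.derivative (p - q) = 0 := by simp [h]
  have hc := Polynomial.eq_C_of_derivative_eq_zero hd
  rw [Polynomial.coeff_zero_eq_eval_zero, Polynomial.eval_sub, h0, sub_self, map_zero] at hc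
  exact sub_eq_zero.mp hc

theorem dvd_picard {V : K⟦X⟧} (hV : X ^ 2 ∣ V) {T : (Polynomial K)⟦X⟧} (hT : X ∣ T) :
    X ∣ picard V T := by
  have h := dvd_subst_sub hV hT (dvd_zero X) (n := 0) (by simp)
  have h0 : (V.subst (0 : (Polynomial K)⟦X⟧) : (Polynomial K)⟦X⟧) = 0 :=
    subst_zero_of_constantCoeff_zero (X_dvd_iff.mp ((dvd_pow_self X two_ne_zero).trans hV))
  rw [h0, sub_zero, zero_add, pow_one, X_dvd_iff] at h
  rw [picard, X_dvd_iff]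
  rw [← coeff_zero_eq_constantCoeff_apply] at h ⊢
  rw [map_add, coeff_mk, h, antideriv_zero, coeff_zero_X, add_zero]

theorem dvd_picard_sub {V : K⟦X⟧} (hV : X ^ 2 ∣ V) {S T : (Polynomial K)⟦X⟧} (hS : X ∣ S)
    (hT : X ∣ T) {n : ℕ} (h : X ^ n ∣ S - T) : X ^ (n + 1) ∣ picard V S - picard V T := by
  have h' := dvd_subst_sub hV hS hT h
  rw [X_pow_dvd_iff] at h' ⊢
  intro i hi
  have := h' i hi
  rw [map_sub, sub_eq_zero] at this
  simp [picard, this]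

theorem dvd_iterate_picard {V : K⟦X⟧} (hV : X ^ 2 ∣ V) (n : ℕ) : X ∣ (picard V)^[n] X := by
  induction n with
  | zero => simp
  | succ n ih => rw [Function.iterate_succ_apply']; exact dvd_picard hV ih

theorem dvd_iterate_sub {V : K⟦X⟧} (hV : X ^ 2 ∣ V) {T : (Polynomial K)⟦X⟧} (hT : X ∣ T) (n : ℕ) :
    X ^ (n + 1) ∣ (picard V)^[n] T - (picard V)^[n] X := by
  have hd : ∀ k, X ∣ (picard V)^[k] T := fun k => by
    induction k with
    | zero => simpa
    | succ k ih => rw [Function.iterate_succ_apply']; exact dvd_picard hV ih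
  induction n with
  | zero => simpa using dvd_sub hT dvd_rfl
  | succ n ih =>
    rw [Function.iterate_succ_apply', Function.iterate_succ_apply']
    exact dvd_picard_sub hV (hd n) (dvd_iterate_picard hV n) ih

theorem dvd_flow_sub {V : K⟦X⟧} (hV : X ^ 2 ∣ V) (n : ℕ) :
    X ^ (n + 1) ∣ flow V - (picard V)^[n] X := by
  rw [X_pow_dvd_iff]
  intro i hi
  obtain ⟨k, rfl⟩ : ∃ k, n = i + k := ⟨n - i, by omega⟩
  have := X_pow_dvd_iff.mp (dvd_iterate_sub hV (dvd_iterate_picard hV k) i) i (Nat.lt_succ_self i)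
  rw [map_sub, sub_eq_zero] at this
  rw [Function.iterate_add_apply, map_sub, this]
  simp [flow]

theorem dvd_flow {V : K⟦X⟧} (hV : X ^ 2 ∣ V) : X ∣ flow V := by
  have h := dvd_flow_sub hV 0
  rw [zero_add, pow_one] at h
  exact (dvd_sub_left (dvd_iterate_picard hV 0)).mp h

theorem picard_flow {V : K⟦X⟧} (hV : X ^ 2 ∣ V) : picard V (flow V) = flow V := by
  ext1 n
  have h1 := dvd_picard_sub hV (dvd_flow hV) (dvd_iterate_picard hV n) (dvd_flow_sub hV n)
  rw [← Function.iterate_succ_apply' (picard V)] at h1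
  have h := X_pow_dvd_iff.mp (dvd_sub h1 (dvd_flow_sub hV (n + 1))) n (by omega)
  simpa [sub_eq_zero] using h

theorem isFormalFlow_iff [CharZero K] {V : K⟦X⟧} {T : (Polynomial K)⟦X⟧} :
    IsFormalFlow V T ↔ X ∣ T ∧ picard V T = T := by
  rw [IsFormalFlow, X_dvd_iff]
  refine and_congr_right fun _ => ⟨fun ⟨h0, h⟩ => ?_, fun h => ⟨?_, ?_⟩⟩
  · ext1 n
    refine eq_of_derivative_eq ?_ ?_
    · have := congrArg (coeff n) h
      simp only [timeDeriv, coeff_mk] at this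
      rw [this]
      by_cases hn : n = 1 <;> simp [picard, derivative_antideriv, coeff_X, hn]
    · have := congrArg (coeff n) h0
      simp only [coeff_map, Polynomial.coe_evalRingHom] at this
      rw [this]
      by_cases hn : n = 1 <;> simp [picard, eval_antideriv, coeff_X, hn]
  · ext n
    conv_lhs => rw [← h]
    by_cases hn : n = 1 <;> simp [picard, eval_antideriv, coeff_X, hn]
  · ext1 n
    conv_lhs => rw [← h]
    by_cases hn : n = 1 <;> simp [timeDeriv, picard, derivative_antideriv, coeff_X, hn]

/-- The formal flow exists. -/
theorem isFormalFlow_flow [CharZero K] {V : K⟦X⟧} (hV : X ^ 2 ∣ V) : IsFormalFlow V (flow V) :=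
  isFormalFlow_iff.mpr ⟨dvd_flow hV, picard_flow hV⟩

/-- The formal flow is unique. -/
theorem IsFormalFlow.eq_flow [CharZero K] {V : K⟦X⟧} (hV : X ^ 2 ∣ V) {T : (Polynomial K)⟦X⟧}
    (hT : IsFormalFlow V T) : T = flow V := by
  obtain ⟨hd, hp⟩ := isFormalFlow_iff.mp hT
  ext1 n
  have h := dvd_iterate_sub hV hd n
  rw [Function.iterate_fixed hp] at h
  have := X_pow_dvd_iff.mp (dvd_sub h (dvd_flow_sub hV n)) n (Nat.lt_succ_self n)
  simpa [sub_eq_zero] using this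

/-- The coefficient of the vector field `x ^ m / (1 - (μ - m / 2) x ^ (m - 1)) ∂/∂x`. -/
noncomputable def modelField (m : ℕ) (μ : K) : K⟦X⟧ :=
  X ^ m * (1 - C (μ - (m : K) / 2) * X ^ (m - 1))⁻¹

theorem X_sq_dvd_modelField {m : ℕ} (hm : 2 ≤ m) (μ : K) : X ^ 2 ∣ modelField m μ :=
  Dvd.dvd.mul_right (pow_dvd_pow X hm) _

end Flow

end NonArchGerm

/-! Write m = q + 1. For germs x + α x^(q+1) + ... with α ≠ 0, the conjugacy equation u ∘ f = g ∘ u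
is triangular: among series tangent to the identity, changing the coefficient of x^n in u alters the
defect u ∘ f - g ∘ u first in degree n + q, by (n - (q+1)) α times the change
(`dvd_defect_sub_defect`). Only n = q + 1 is resonant. Hence two germs with α = 1 that agree through
degree 2q+1 are formally conjugate (`exists_comp_eq_comp`), and a conjugacy tangent to the identity
is determined by its coefficient of x^(q+1) (`eq_of_defect_eq_zero`).

The model field is chosen so that its time-one map agrees with x + x^m + μ x^(2m-1) through degree
2q+1, so f is formally conjugate to T^1. The maps T^t commute with T^1 and have resonant coefficient
t, so every t in K is realized and they exhaust the formal centralizer of T^1; transport by h gives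
`formalCentralizer_eq`.

Analyticity comes from `isLocallyAnalytic_of_defect_eq_zero`. Solving for the coefficient of
x^(q+2+p) costs a division by (p+1) α. By the ultrametric inequality only single products have to be
estimated, and the factorials accumulated in such a product divide p!. So the coefficient of x^(k+1)
is at most S^k / |(k-q)!|, and 1/|n!| grows at most geometrically (`exists_inv_norm_factorial_le`).
The same growth makes every time map analytic (`isLocallyAnalytic_timeMap`). Dilations reduce a
general h'(0) to 1, and a series commuting with f is a conjugacy from f to itself, so the two
centralizers coincide. -/

open PowerSeries

namespace NonArchGerm

/-! ### Congruences modulo powers of x under powers and substitution -/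

section Formal

variable {R A : Type*} [CommRing R] [CommRing A] [Algebra R A]

theorem X_dvd_sub_C (p : A⟦X⟧) : X ∣ p - C (constantCoeff p) := by
  rw [X_dvd_iff]; simp

theorem X_pow_dvd_of_coeff_eq_zero {p : A⟦X⟧} {n : ℕ} (h : X ^ n ∣ p) (hn : coeff n p = 0) :
    X ^ (n + 1) ∣ p := by
  rw [X_pow_dvd_iff] at h ⊢
  intro i hi
  rcases Nat.lt_succ_iff_lt_or_eq.mp hi with hi | rfl
  · exact h i hi
  · exact hn

theorem coeff_eq_of_dvd_sub {p q : A⟦X⟧} {n k : ℕ} (h : X ^ n ∣ p - q) (hk : k < n) :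
    coeff k p = coeff k q := by
  have := X_pow_dvd_iff.mp h k hk
  rwa [map_sub, sub_eq_zero] at this

theorem eq_of_forall_X_pow_dvd_sub {p q : A⟦X⟧} (h : ∀ n, X ^ n ∣ p - q) : p = q := by
  ext n
  exact coeff_eq_of_dvd_sub (h (n + 1)) (Nat.lt_succ_self n)

theorem HasSubst.of_X_dvd {T : A⟦X⟧} (hT : X ∣ T) : HasSubst T :=
  HasSubst.of_constantCoeff_zero' (X_dvd_iff.mp hT)

/-- The coefficients of a composition are finite sums. -/
theorem coeff_subst_eq_sum (f : R⟦X⟧) {b : A⟦X⟧} (hb : X ∣ b) {e N : ℕ} (h : e < N) :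
    coeff e (f.subst b : A⟦X⟧) = ∑ d ∈ Finset.range N, coeff d f • coeff e (b ^ d) := by
  rw [coeff_subst' (HasSubst.of_X_dvd hb), finsum_eq_sum_of_support_subset]
  intro d hd
  by_contra hdN
  refine hd ?_
  have : coeff e (b ^ d) = 0 := by
    refine X_pow_dvd_iff.mp (pow_dvd_pow_of_dvd hb d) e ?_
    simp only [Finset.coe_range, Set.mem_Iio, not_lt] at hdN
    omega
  simp [this]

theorem X_pow_dvd_subst {V : R⟦X⟧} {m : ℕ} (hV : X ^ m ∣ V) {T : A⟦X⟧} (hT : X ∣ T) :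
    X ^ m ∣ (V.subst T : A⟦X⟧) := by
  obtain ⟨w, rfl⟩ := hV
  rw [subst_mul (HasSubst.of_X_dvd hT), subst_pow (HasSubst.of_X_dvd hT),
    subst_X (HasSubst.of_X_dvd hT)]
  exact Dvd.dvd.mul_right (pow_dvd_pow_of_dvd hT m) _

/-- In S^(j+1) - T^(j+1) = (S - T) ∑ S^i T^(j-i), every term of the sum has order at least j. -/
theorem X_pow_dvd_pow_sub_pow {S T : A⟦X⟧} (hS : X ∣ S) (hT : X ∣ T) {n : ℕ}
    (h : X ^ n ∣ S - T) (j : ℕ) : X ^ (n + j) ∣ S ^ (j + 1) - T ^ (j + 1) := by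
  rw [pow_add, ← (Commute.all S T).mul_geom_sum₂ (j + 1)]
  refine mul_dvd_mul h (Finset.dvd_sum fun i hi => ?_)
  rw [Finset.mem_range] at hi
  have : j = i + (j - i) := by omega
  conv_lhs => rw [this, pow_add]
  exact mul_dvd_mul (pow_dvd_pow_of_dvd hS _)
    (by rw [show j + 1 - 1 - i = j - i by omega]; exact pow_dvd_pow_of_dvd hT _)

/-- Substitution into a series of order at least `m + 1` improves congruences by `m` orders. -/
theorem X_pow_dvd_subst_sub {V : R⟦X⟧} {m : ℕ} (hV : X ^ (m + 1) ∣ V) {S T : A⟦X⟧}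
    (hS : X ∣ S) (hT : X ∣ T) {n : ℕ} (h : X ^ n ∣ S - T) :
    X ^ (n + m) ∣ (V.subst S : A⟦X⟧) - V.subst T := by
  rw [X_pow_dvd_iff]
  intro i hi
  rw [map_sub, coeff_subst_eq_sum V hS (Nat.lt_succ_self i),
    coeff_subst_eq_sum V hT (Nat.lt_succ_self i), sub_eq_zero]
  refine Finset.sum_congr rfl fun d _ => ?_
  by_cases hd : d < m + 1
  · rw [X_pow_dvd_iff.mp hV d hd, zero_smul, zero_smul]
  · obtain ⟨j, rfl⟩ : ∃ j, d = j + 1 := ⟨d - 1, by omega⟩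
    rw [coeff_eq_of_dvd_sub (X_pow_dvd_pow_sub_pow hS hT h j) (by omega)]

/-- The leading term of a difference of powers of two series tangent to the identity. -/
theorem X_pow_dvd_pow_sub_pow_sub {S T : A⟦X⟧} (hS : X ∣ S) (hS1 : coeff 1 S = 1) (hT : X ∣ T)
    (hT1 : coeff 1 T = 1) {n : ℕ} (h : X ^ n ∣ S - T) (j : ℕ) :
    X ^ (n + j + 1) ∣
      S ^ (j + 1) - T ^ (j + 1) - C (((j : A) + 1) * coeff n (S - T)) * X ^ (n + j) := by
  rw [← (Commute.all S T).mul_geom_sum₂ (j + 1)]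
  obtain ⟨w, hw⟩ := h
  obtain ⟨s, rfl⟩ := hS
  obtain ⟨t, rfl⟩ := hT
  rw [← zero_add 1, coeff_succ_X_mul, coeff_zero_eq_constantCoeff_apply] at hS1 hT1
  have hsum : ∑ i ∈ Finset.range (j + 1), (X * s) ^ i * (X * t) ^ (j + 1 - 1 - i) =
      X ^ j * ∑ i ∈ Finset.range (j + 1), s ^ i * t ^ (j - i) := by
    rw [Finset.mul_sum]
    refine Finset.sum_congr rfl fun i hi => ?_
    rw [Finset.mem_range] at hi
    have : j = i + (j - i) := by omega
    conv_rhs => rw [this, pow_add]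
    rw [show j + 1 - 1 - i = j - i by omega, show i + (j - i) - i = j - i by omega]
    ring
  rw [hsum, hw]
  have hc : constantCoeff (w * ∑ i ∈ Finset.range (j + 1), s ^ i * t ^ (j - i)) =
      ((j : A) + 1) * coeff n (X ^ n * w) := by
    have : coeff n (X ^ n * w) = constantCoeff w := by
      simpa using coeff_X_pow_mul w n 0
    rw [this]
    simp [hS1, hT1, mul_comm]
  rw [← hc]
  obtain ⟨y, hy⟩ := X_dvd_sub_C (w * ∑ i ∈ Finset.range (j + 1), s ^ i * t ^ (j - i))
  refine ⟨y, ?_⟩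
  linear_combination X ^ (n + j) * hy

end Formal

/-! ### The formal conjugacy equation and its resonance -/

section Conjugacy

variable {K : Type*} [Field K]

theorem comp_assoc (f : K⟦X⟧) {g k : K⟦X⟧} (hg : X ∣ g) (hk : X ∣ k) :
    comp (comp f g) k = comp f (comp g k) :=
  subst_comp_subst_apply (HasSubst.of_X_dvd hg) (HasSubst.of_X_dvd hk) f

theorem comp_X (f : K⟦X⟧) : comp f X = f := X_subst f

theorem X_comp {f : K⟦X⟧} (hf : X ∣ f) : comp X f = f := subst_X (HasSubst.of_X_dvd hf)

theorem X_dvd_comp {f g : K⟦X⟧} (hf : X ∣ f) (hg : X ∣ g) : X ∣ comp f g := by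
  have := X_pow_dvd_subst (m := 1) (by simpa using hf) hg
  rwa [pow_one] at this

theorem coeff_one_comp {f g : K⟦X⟧} (hg : X ∣ g) :
    coeff 1 (comp f g) = coeff 1 f * coeff 1 g := by
  rw [comp, coeff_subst_eq_sum f hg (Nat.lt_succ_self 1)]
  simp [Finset.sum_range_succ, coeff_one]

/-- `f(x) = x + α x ^ (q + 1) + O(x ^ (q + 2))`. -/
def HasLeadingTerm (f : K⟦X⟧) (q : ℕ) (α : K) : Prop :=
  X ^ (q + 2) ∣ f - (X + C α * X ^ (q + 1))

theorem HasLeadingTerm.dvd_sub_X {f : K⟦X⟧} {q : ℕ} {α : K} (hf : HasLeadingTerm f q α) :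
    X ^ (q + 1) ∣ f - X := by
  have h1 : X ^ (q + 1) ∣ f - (X + C α * X ^ (q + 1)) := (pow_dvd_pow _ (by omega)).trans hf
  have h2 : (X : K⟦X⟧) ^ (q + 1) ∣ C α * X ^ (q + 1) := Dvd.intro_left _ rfl
  have h := dvd_add h1 h2
  rwa [sub_add_eq_sub_sub, sub_add_cancel] at h

theorem HasLeadingTerm.X_dvd {f : K⟦X⟧} {q : ℕ} {α : K} (hf : HasLeadingTerm f q α) :
    X ∣ f := by
  have h1 : X ∣ f - X := (dvd_pow_self X (by omega)).trans hf.dvd_sub_X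
  exact (dvd_sub_left dvd_rfl).mp h1

theorem HasLeadingTerm.coeff_one {f : K⟦X⟧} {q : ℕ} {α : K} (hf : HasLeadingTerm f q α)
    (hq : 1 ≤ q) : coeff 1 f = 1 := by
  rw [coeff_eq_of_dvd_sub hf.dvd_sub_X (by omega)]
  simp

theorem HasLeadingTerm.coeff_sub_X {f : K⟦X⟧} {q : ℕ} {α : K} (hf : HasLeadingTerm f q α) :
    coeff (q + 1) (f - X) = α := by
  rw [map_sub, coeff_eq_of_dvd_sub hf (by omega)]
  simp [coeff_X_pow]

theorem comp_sub_left (u v : K⟦X⟧) {f : K⟦X⟧} (hf : X ∣ f) :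
    comp (u - v) f = comp u f - comp v f :=
  subst_sub (HasSubst.of_X_dvd hf) u v

/-- The leading term of `d ∘ f - d`. -/
theorem HasLeadingTerm.dvd_comp_sub_self {f : K⟦X⟧} {q : ℕ} {α : K} (hf : HasLeadingTerm f q α)
    (hq : 1 ≤ q) {d : K⟦X⟧} {k : ℕ} (hd : X ^ (k + 1) ∣ d) :
    X ^ (k + 1 + q + 1) ∣ comp d f - d - C (((k : K) + 1) * α * coeff (k + 1) d) *
      X ^ (k + 1 + q) := by
  obtain ⟨w, rfl⟩ := hd
  have hs := HasSubst.of_X_dvd hf.X_dvd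
  have hc : coeff (k + 1) (X ^ (k + 1) * w) = constantCoeff w := by
    simpa using coeff_X_pow_mul w (k + 1) 0
  rw [hc, comp, subst_mul hs, subst_pow hs, subst_X hs]
  have h1 := X_pow_dvd_pow_sub_pow_sub hf.X_dvd (hf.coeff_one hq) dvd_rfl (by simp)
    hf.dvd_sub_X k
  rw [hf.coeff_sub_X] at h1
  obtain ⟨y, hy⟩ := h1
  have h2 : X ∣ w.subst f - C (constantCoeff w) := by
    have := X_pow_dvd_subst (m := 1) (T := f) (by simpa using X_dvd_sub_C w) hf.X_dvd
    rw [subst_sub hs, pow_one] at this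
    have hC : (C (constantCoeff w)).subst f = C (constantCoeff w) := subst_C _
    rwa [hC] at this
  obtain ⟨z, hz⟩ := h2
  have h3 : X ^ (q + 1) ∣ w.subst f - w := by
    have := X_pow_dvd_subst_sub (m := 0) (by simpa using X_dvd_sub_C w) hf.X_dvd dvd_rfl
      hf.dvd_sub_X
    rw [subst_sub hs, X_subst, add_zero] at this
    have hC : (C (constantCoeff w)).subst f = C (constantCoeff w) := subst_C _
    rw [hC] at this
    simpa using this
  obtain ⟨r, hr⟩ := h3
  -- With d = x^(k+1) w, the term (f^(k+1) - x^(k+1)) (w ∘ f) carries the leading part; x^(k+1) (w ∘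
  -- f - w) is one order smaller.
  refine ⟨y * w.subst f + C (((k : K) + 1) * α) * z + r, ?_⟩
  rw [map_mul]
  linear_combination (w.subst f) * hy + C (((k : K) + 1) * α) * X ^ (q + 1 + k) * hz
    + X ^ (k + 1) * hr

/-- The defect of `u` as a conjugacy from `f` to `g`. -/
noncomputable def defect (f g u : K⟦X⟧) : K⟦X⟧ := comp u f - comp g u

/-- The linearization of the conjugacy equation. -/
theorem dvd_defect_sub_defect {f g : K⟦X⟧} {q : ℕ} {α : K} (hf : HasLeadingTerm f q α)
    (hg : HasLeadingTerm g q α) (hq : 1 ≤ q) {u v : K⟦X⟧} (hu : X ∣ u) (hu1 : coeff 1 u = 1)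
    (hv : X ∣ v) (hv1 : coeff 1 v = 1) {n : ℕ} (hn : 1 ≤ n) (h : X ^ n ∣ u - v) :
    X ^ (n + q + 1) ∣ defect f g u - defect f g v -
      C (((n : K) - ((q : K) + 1)) * α * coeff n (u - v)) * X ^ (n + q) := by
  obtain ⟨k, rfl⟩ : ∃ k, n = k + 1 := ⟨n - 1, by omega⟩
  have h1 := hf.dvd_comp_sub_self hq h
  rw [comp_sub_left _ _ hf.X_dvd] at h1
  have h2 := X_pow_dvd_pow_sub_pow_sub hu hu1 hv hv1 h q
  have h3 := X_pow_dvd_subst_sub hg hu hv h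
  have key : ∀ w : K⟦X⟧, X ∣ w → (g - (X + C α * X ^ (q + 1))).subst w =
      comp g w - (w + C α * w ^ (q + 1)) := fun w hw => by
    have hs := HasSubst.of_X_dvd hw
    have hC : (C α).subst w = C α := subst_C _
    rw [subst_sub hs, subst_add hs, subst_mul hs, subst_pow hs, subst_X hs, hC, comp]
  rw [key u hu, key v hv] at h3
  obtain ⟨a, ha⟩ := h1
  obtain ⟨b, hb⟩ := h2
  obtain ⟨c, hc⟩ := h3
  -- The factor n comes from (u - v) ∘ f - (u - v), the factor q + 1 from α (u^(q+1) - v^(q+1)); the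
  -- tail of g beyond degree q + 1 contributes only to higher order.
  refine ⟨a - C α * b - c, ?_⟩
  simp only [map_mul, map_sub, map_add, map_natCast, map_one, Nat.cast_add, Nat.cast_one,
    defect] at *
  linear_combination ha - C α * hb - hc

/-- Two conjugacies that agree up to the resonant coefficient agree. -/
theorem eq_of_defect_eq_zero [CharZero K] {f g : K⟦X⟧} {q : ℕ} {α : K} (hα : α ≠ 0)
    (hf : HasLeadingTerm f q α)
    (hg : HasLeadingTerm g q α) (hq : 1 ≤ q) {u v : K⟦X⟧} (hu : X ∣ u) (hu1 : coeff 1 u = 1)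
    (hv : X ∣ v) (hv1 : coeff 1 v = 1) (hEu : defect f g u = 0) (hEv : defect f g v = 0)
    (hr : coeff (q + 1) u = coeff (q + 1) v) : u = v := by
  refine eq_of_forall_X_pow_dvd_sub fun n => ?_
  induction n with
  | zero => simp
  | succ n ih =>
    refine X_pow_dvd_of_coeff_eq_zero ih ?_
    by_cases h0 : n = 0
    · subst h0
      simp [X_dvd_iff.mp hu, X_dvd_iff.mp hv]
    by_cases hnq : n = q + 1
    · rw [hnq, map_sub, hr, sub_self]
    have h := X_pow_dvd_iff.mp (dvd_defect_sub_defect hf hg hq hu hu1 hv hv1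
      (Nat.one_le_iff_ne_zero.mpr h0) ih) (n + q) (Nat.lt_succ_self _)
    rw [hEu, hEv] at h
    have hne : (n : K) - ((q : K) + 1) ≠ 0 := by
      rw [sub_ne_zero]; exact_mod_cast hnq
    rw [map_sub, coeff_C_mul, coeff_X_pow_self, sub_zero, map_zero, zero_sub, neg_eq_zero,
      mul_one] at h
    exact (mul_eq_zero.mp h).resolve_left (mul_ne_zero hne hα)

/-- The successive corrections in the construction of a formal conjugacy. -/
noncomputable def conjApprox (f g : K⟦X⟧) (q : ℕ) : ℕ → K⟦X⟧
  | 0 => X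
  | k + 1 => conjApprox f g q k -
      C (coeff (q + 2 + k + q) (defect f g (conjApprox f g q k)) / ((k : K) + 1)) *
        X ^ (q + 2 + k)

theorem conjApprox_dvd (f g : K⟦X⟧) (q k : ℕ) : X ^ 2 ∣ conjApprox f g q k - X := by
  induction k with
  | zero => simp [conjApprox]
  | succ k ih =>
    rw [conjApprox, sub_right_comm]
    exact dvd_sub ih (Dvd.dvd.mul_left (pow_dvd_pow _ (by omega)) _)

theorem X_dvd_of_dvd_sub_X {u : K⟦X⟧} (h : X ^ 2 ∣ u - X) : X ∣ u :=
  (dvd_sub_left dvd_rfl).mp ((dvd_pow_self X two_ne_zero).trans h)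

theorem coeff_one_of_dvd_sub_X {u : K⟦X⟧} (h : X ^ 2 ∣ u - X) : coeff 1 u = 1 := by
  rw [coeff_eq_of_dvd_sub h (by omega), coeff_one_X]

/-- The initial defect f - g already has order 2q+2, so corrections start in degree q + 2, just past
the resonance. There the divisor (q+2+k) - (q+1) = k + 1 is invertible, and each correction cancels
the leading term of the current defect. -/
theorem dvd_defect_conjApprox [CharZero K] {f g : K⟦X⟧} {q : ℕ} (hf : HasLeadingTerm f q 1)
    (hg : HasLeadingTerm g q 1) (hq : 1 ≤ q) (hfg : X ^ (2 * q + 2) ∣ f - g) (k : ℕ) :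
    X ^ (q + 2 + k + q) ∣ defect f g (conjApprox f g q k) := by
  induction k with
  | zero =>
    rw [conjApprox, defect, comp_X, X_comp hf.X_dvd]
    exact (pow_dvd_pow _ (by omega)).trans hfg
  | succ k ih =>
    set u := conjApprox f g q k with hu
    set c := coeff (q + 2 + k + q) (defect f g u) / ((k : K) + 1) with hc
    have hu' : conjApprox f g q (k + 1) = u - C c * X ^ (q + 2 + k) := rfl
    have hdiff : conjApprox f g q (k + 1) - u = - (C c * X ^ (q + 2 + k)) := by rw [hu']; ring
    have h1 := conjApprox_dvd f g q (k + 1)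
    have h2 := conjApprox_dvd f g q k
    have h := dvd_defect_sub_defect (n := q + 2 + k) hf hg hq (X_dvd_of_dvd_sub_X h1)
      (coeff_one_of_dvd_sub_X h1) (X_dvd_of_dvd_sub_X h2) (coeff_one_of_dvd_sub_X h2)
      (by omega) (by rw [← hu, hdiff]; exact (dvd_neg.mpr (Dvd.intro_left _ rfl)))
    rw [← hu, hdiff] at h
    have hk : (k : K) + 1 ≠ 0 := by exact_mod_cast k.succ_ne_zero
    have hcoef : (((q + 2 + k : ℕ) : K) - ((q : K) + 1)) * 1 *
        coeff (q + 2 + k) (-(C c * X ^ (q + 2 + k))) =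
        - coeff (q + 2 + k + q) (defect f g u) := by
      rw [map_neg, coeff_C_mul, coeff_X_pow_self, hc]
      push_cast
      field_simp
      ring
    rw [hcoef] at h
    have e : q + 2 + (k + 1) + q = q + 2 + k + q + 1 := by omega
    rw [e]
    have h3 : X ^ (q + 2 + k + q + 1) ∣ defect f g u -
        C (coeff (q + 2 + k + q) (defect f g u)) * X ^ (q + 2 + k + q) := by
      refine X_pow_dvd_of_coeff_eq_zero (dvd_sub ih (Dvd.intro_left _ rfl)) ?_
      simp [coeff_X_pow]
    have := dvd_add h h3
    convert this using 1
    rw [map_neg]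
    ring

/-- Series with the same terms up to order `2 q + 1` are formally conjugate. -/
theorem exists_comp_eq_comp [CharZero K] {f g : K⟦X⟧} {q : ℕ} (hf : HasLeadingTerm f q 1)
    (hg : HasLeadingTerm g q 1) (hq : 1 ≤ q) (hfg : X ^ (2 * q + 2) ∣ f - g) :
    ∃ u : K⟦X⟧, TangentToId u ∧ comp u f = comp g u := by
  set a := conjApprox f g q with ha
  have hstep : ∀ n k, X ^ (q + 2 + n) ∣ a (n + k) - a n := by
    intro n k
    induction k with
    | zero => simp
    | succ k ih =>
      have h : a (n + (k + 1)) - a n = (a (n + k) - a n) -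
          C (coeff (q + 2 + (n + k) + q) (defect f g (a (n + k))) / (((n + k : ℕ) : K) + 1)) *
            X ^ (q + 2 + (n + k)) := by
        rw [← add_assoc, ha, conjApprox]; ring
      rw [h]
      exact dvd_sub ih (Dvd.dvd.mul_left (pow_dvd_pow _ (by omega)) _)
  -- The corrections after step n start in degree q + 2 + n, so the coefficient of x^n is already
  -- final in `a n`.
  set u : K⟦X⟧ := PowerSeries.mk fun n => coeff n (a n) with hu
  have hua : ∀ n, X ^ (q + 2 + n) ∣ u - a n := by
    intro n
    rw [X_pow_dvd_iff]
    intro i hi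
    rw [map_sub, hu, coeff_mk, sub_eq_zero]
    rcases le_total i n with h | h
    · obtain ⟨k, rfl⟩ := Nat.exists_eq_add_of_le h
      exact (coeff_eq_of_dvd_sub (hstep i k) (by omega)).symm
    · obtain ⟨k, rfl⟩ := Nat.exists_eq_add_of_le h
      exact coeff_eq_of_dvd_sub (hstep n k) hi
  have hu2 : X ^ 2 ∣ u - X := by
    have := dvd_add ((pow_dvd_pow X (by omega)).trans (hua 0)) (conjApprox_dvd f g q 0)
    rwa [← ha, sub_add_sub_cancel] at this
  have hX := X_dvd_of_dvd_sub_X hu2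
  refine ⟨u, ⟨X_dvd_iff.mp hX, coeff_one_of_dvd_sub_X hu2⟩, ?_⟩
  refine eq_of_forall_X_pow_dvd_sub fun n => ?_
  have h2 := conjApprox_dvd f g q n
  have h := dvd_defect_sub_defect (n := q + 2 + n) hf hg hq hX (coeff_one_of_dvd_sub_X hu2)
    (X_dvd_of_dvd_sub_X h2) (coeff_one_of_dvd_sub_X h2) (by omega) (hua n)
  have h3 := dvd_defect_conjApprox hf hg hq hfg n
  have h4 := dvd_add (dvd_add ((pow_dvd_pow X (show n ≤ _ by omega)).trans h)
    ((pow_dvd_pow X (show n ≤ q + 2 + n + q by omega)).trans h3))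
    (Dvd.dvd.mul_left (pow_dvd_pow X (show n ≤ q + 2 + n + q by omega))
      (C ((((q + 2 + n : ℕ) : K) - ((q : K) + 1)) * 1 * coeff (q + 2 + n) (u - conjApprox f g q n))))
  convert h4 using 1
  rw [defect, defect]
  ring

/-- The coefficient of a conjugacy beyond the resonance, in terms of the truncated conjugacy. -/
theorem coeff_mul_eq_of_defect_eq_zero {f g h : K⟦X⟧} {q : ℕ} {α : K}
    (hf : HasLeadingTerm f q α) (hg : HasLeadingTerm g q α) (hq : 1 ≤ q) (hh : X ∣ h)
    (hh1 : coeff 1 h = 1) (hE : defect f g h = 0) (p : ℕ) {u : K⟦X⟧}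
    (hu : u = PowerSeries.mk fun i => if i < q + 2 + p then coeff i h else 0) :
    ((p : K) + 1) * α * coeff (q + 2 + p) h = - coeff (2 * q + 2 + p) (defect f g u) := by
  have hcu : ∀ i, coeff i u = if i < q + 2 + p then coeff i h else 0 := fun i => by
    rw [hu, coeff_mk]
  have hd : X ^ (q + 2 + p) ∣ h - u := by
    rw [X_pow_dvd_iff]
    intro i hi
    rw [map_sub, hcu, if_pos hi, sub_self]
  have hu0 : X ∣ u := by
    rw [X_dvd_iff, ← coeff_zero_eq_constantCoeff_apply, hcu, if_pos (by omega),
      coeff_zero_eq_constantCoeff_apply, X_dvd_iff.mp hh]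
  have hu1 : coeff 1 u = 1 := by rw [hcu, if_pos (by omega), hh1]
  have h := X_pow_dvd_iff.mp (dvd_defect_sub_defect hf hg hq hh hh1 hu0 hu1 (by omega) hd)
    (q + 2 + p + q) (Nat.lt_succ_self _)
  rw [hE, map_sub, map_sub, coeff_C_mul, coeff_X_pow_self, map_sub, hcu, if_neg (by omega),
    map_zero] at h
  rw [show 2 * q + 2 + p = q + 2 + p + q by omega]
  push_cast at h
  linear_combination -h

end Conjugacy

/-! ### The formal flow: group law and first coefficients -/

section FlowLaws

variable {K : Type*} [Field K]

theorem X_dvd_map {A B : Type*} [CommRing A] [CommRing B] (φ : A →+* B) {T : A⟦X⟧}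
    (hT : X ∣ T) : X ∣ PowerSeries.map φ T := by
  rw [X_dvd_iff] at hT ⊢
  rw [← coeff_zero_eq_constantCoeff_apply] at hT ⊢
  rw [coeff_map, hT, map_zero]

theorem map_subst_algHom {A B : Type*} [CommRing A] [CommRing B] [Algebra K A] [Algebra K B]
    (φ : A →ₐ[K] B) (V : K⟦X⟧) {T : A⟦X⟧} (hT : X ∣ T) :
    PowerSeries.map (φ : A →+* B) (V.subst T) =
      V.subst (PowerSeries.map (φ : A →+* B) T) := by
  have hT' := X_dvd_map (φ : A →+* B) hT
  ext e
  rw [coeff_map, coeff_subst_eq_sum V hT (Nat.lt_succ_self e),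
    coeff_subst_eq_sum V hT' (Nat.lt_succ_self e), map_sum]
  refine Finset.sum_congr rfl fun d _ => ?_
  rw [← map_pow, coeff_map]
  exact map_smul φ _ _

theorem map_subst_ringHom {A B : Type*} [CommRing A] [CommRing B] (φ : A →+* B) (U : A⟦X⟧)
    {T : A⟦X⟧} (hT : X ∣ T) : PowerSeries.map φ (U.subst T) =
      (PowerSeries.map φ U).subst (PowerSeries.map φ T) := by
  have hT' := X_dvd_map φ hT
  ext e
  rw [coeff_map, coeff_subst_eq_sum U hT (Nat.lt_succ_self e),
    coeff_subst_eq_sum _ hT' (Nat.lt_succ_self e), map_sum]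
  refine Finset.sum_congr rfl fun d _ => ?_
  rw [← map_pow, coeff_map, coeff_map, smul_eq_mul, smul_eq_mul, map_mul]

theorem timeDeriv_map_comp (s : K) (T : (Polynomial K)⟦X⟧) :
    timeDeriv (PowerSeries.map
      ((Polynomial.aeval (Polynomial.X + Polynomial.C s) :
        Polynomial K →ₐ[K] Polynomial K) : Polynomial K →+* Polynomial K) T) =
    PowerSeries.map ((Polynomial.aeval (Polynomial.X + Polynomial.C s) :
        Polynomial K →ₐ[K] Polynomial K) : Polynomial K →+* Polynomial K) (timeDeriv T) := by
  ext1 n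
  simp only [timeDeriv, coeff_mk, coeff_map]
  change Polynomial.derivative (Polynomial.aeval _ _) = Polynomial.aeval _ _
  rw [← Polynomial.comp_eq_aeval, ← Polynomial.comp_eq_aeval, Polynomial.derivative_comp]
  simp

theorem timeDeriv_subst_map_C (T : (Polynomial K)⟦X⟧) {S : K⟦X⟧} (hS : X ∣ S) :
    timeDeriv (T.subst (PowerSeries.map Polynomial.C S)) =
      (timeDeriv T).subst (PowerSeries.map Polynomial.C S) := by
  have hS' := X_dvd_map Polynomial.C hS
  ext1 e
  rw [timeDeriv, coeff_mk, coeff_subst_eq_sum T hS' (Nat.lt_succ_self e),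
    coeff_subst_eq_sum _ hS' (Nat.lt_succ_self e), Polynomial.derivative_sum]
  refine Finset.sum_congr rfl fun d _ => ?_
  rw [← map_pow, coeff_map, smul_eq_mul, smul_eq_mul, Polynomial.derivative_mul,
    Polynomial.derivative_C, mul_zero, add_zero, timeDeriv, coeff_mk]

/-- Solutions of `dU/dt = V(U)` are determined by their value at time `0`. -/
theorem eq_of_timeDeriv_eq [CharZero K] {V : K⟦X⟧} (hV : X ^ 2 ∣ V) {U W : (Polynomial K)⟦X⟧}
    (hU : X ∣ U) (hW : X ∣ W) (hUd : timeDeriv U = V.subst U) (hWd : timeDeriv W = V.subst W)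
    (h0 : PowerSeries.map (Polynomial.evalRingHom 0) U =
      PowerSeries.map (Polynomial.evalRingHom 0) W) : U = W := by
  refine eq_of_forall_X_pow_dvd_sub fun n => ?_
  induction n with
  | zero => simp
  | succ n ih =>
    refine X_pow_dvd_of_coeff_eq_zero ih ?_
    rw [map_sub, sub_eq_zero]
    refine eq_of_derivative_eq ?_ ?_
    -- As V = O(x^2), agreement of U and W modulo x^n forces agreement of their time derivatives
    -- modulo x^(n+1).
    · have h := coeff_eq_of_dvd_sub (X_pow_dvd_subst_sub hV hU hW ih) (Nat.lt_succ_self n)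
      rw [← hUd, ← hWd] at h
      simpa [timeDeriv] using h
    · simpa using congrArg (coeff n) h0

theorem X_dvd_timeMap {V : K⟦X⟧} (hV : X ^ 2 ∣ V) (t : K) : X ∣ timeMap V t :=
  X_dvd_map _ (dvd_flow hV)

/-- The group law of the formal flow. -/
theorem comp_timeMap_timeMap [CharZero K] {V : K⟦X⟧} (hV : X ^ 2 ∣ V) (r s : K) :
    comp (timeMap V r) (timeMap V s) = timeMap V (r + s) := by
  obtain ⟨-, hF0, hFd⟩ := isFormalFlow_flow hV
  have hF := dvd_flow hV
  have hS := X_dvd_timeMap hV s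
  have hS' := X_dvd_map Polynomial.C hS
  -- `φ` is the time shift t ↦ t + s. As functions of t, both T^t ∘ T^s and T^(t+s) solve the flow
  -- equation, with the same value T^s at t = 0.
  set φ : Polynomial K →ₐ[K] Polynomial K :=
    Polynomial.aeval (Polynomial.X + Polynomial.C s) with hφ
  have heval : ∀ r : K, PowerSeries.map (Polynomial.evalRingHom r)
      ((flow V).subst (PowerSeries.map Polynomial.C (timeMap V s))) =
      comp (timeMap V r) (timeMap V s) := fun r => by
    rw [map_subst_ringHom _ _ hS', comp, timeMap]
    congr 1
    ext n
    simp
  have heval' : ∀ r : K, PowerSeries.map (Polynomial.evalRingHom r)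
      (PowerSeries.map (φ : Polynomial K →+* Polynomial K) (flow V)) = timeMap V (r + s) :=
    fun r => by
    ext n
    simp only [coeff_map, timeMap, hφ]
    change Polynomial.eval r (Polynomial.aeval _ _) = _
    rw [← Polynomial.comp_eq_aeval, Polynomial.eval_comp]
    simp
  rw [← heval, ← heval']
  congr 1
  refine eq_of_timeDeriv_eq hV ?_ (X_dvd_map _ hF) ?_ ?_ ?_
  · have := X_pow_dvd_subst (m := 1) (by simpa using hF) hS'
    rwa [pow_one] at this
  · rw [timeDeriv_subst_map_C _ hS, hFd]
    exact subst_comp_subst_apply (HasSubst.of_X_dvd hF) (HasSubst.of_X_dvd hS') V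
  · rw [timeDeriv_map_comp, hFd, map_subst_algHom φ V hF]
  · rw [heval, heval', zero_add]
    have : timeMap V 0 = X := hF0
    rw [this, X_comp hS]

theorem comp_timeMap_comm [CharZero K] {V : K⟦X⟧} (hV : X ^ 2 ∣ V) (r s : K) :
    comp (timeMap V r) (timeMap V s) = comp (timeMap V s) (timeMap V r) := by
  rw [comp_timeMap_timeMap hV, comp_timeMap_timeMap hV, add_comm]

theorem coeff_flow_eq [CharZero K] {V : K⟦X⟧} (hV : X ^ 2 ∣ V) {e : ℕ} {p : Polynomial K}
    (hp : Polynomial.derivative p = coeff e (V.subst (flow V) : (Polynomial K)⟦X⟧))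
    (hp0 : p.eval 0 = coeff e (X : K⟦X⟧)) : coeff e (flow V) = p := by
  obtain ⟨-, hF0, hFd⟩ := isFormalFlow_flow hV
  refine eq_of_derivative_eq ?_ ?_
  · rw [hp, ← hFd, timeDeriv, coeff_mk]
  · rw [hp0, ← hF0]; simp

theorem dvd_flow_sub_X [CharZero K] {V : K⟦X⟧} {q : ℕ} (hq : 1 ≤ q) (hV : X ^ (q + 1) ∣ V) :
    X ^ (q + 1) ∣ flow V - X := by
  have hV2 : X ^ 2 ∣ V := (pow_dvd_pow X (by omega)).trans hV
  rw [X_pow_dvd_iff]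
  intro e he
  rw [map_sub, sub_eq_zero, coeff_flow_eq hV2 (p := Polynomial.C (coeff e (X : K⟦X⟧)))]
  · rw [coeff_X, coeff_X]; split_ifs <;> simp
  · rw [Polynomial.derivative_C, X_pow_dvd_iff.mp (X_pow_dvd_subst hV (dvd_flow hV2)) e he]
  · simp

/-- Since T^t ≡ x modulo x^(q+1), V(T^t) ≡ V(x) modulo x^(2q+1): in these degrees the velocity does
not depend on time. -/
theorem coeff_flow_of_lt [CharZero K] {V : K⟦X⟧} {q : ℕ} (hq : 1 ≤ q) (hV : X ^ (q + 1) ∣ V)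
    {e : ℕ} (he : e < 2 * q + 1) : coeff e (flow V) =
      Polynomial.C (coeff e (X : K⟦X⟧)) + Polynomial.C (coeff e V) * Polynomial.X := by
  have hV2 : X ^ 2 ∣ V := (pow_dvd_pow X (by omega)).trans hV
  refine coeff_flow_eq hV2 ?_ (by simp)
  have h := coeff_eq_of_dvd_sub (X_pow_dvd_subst_sub hV (dvd_flow hV2) dvd_rfl
    (dvd_flow_sub_X hq hV)) (show e < q + 1 + q by omega)
  rw [h, ← map_algebraMap_eq_subst_X, coeff_map]
  simp

/-- This is the first degree in which the displacement t x^(q+1) feeds back into the velocity: (x +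
t x^(q+1))^(q+1) contributes (q+1) t, which integrates to (q+1) t^2 / 2. This is the origin of the
shift m/2 in the model field. -/
theorem coeff_flow_two_mul_add_one [CharZero K] {V : K⟦X⟧} {q : ℕ} (hq : 1 ≤ q)
    (hV : X ^ (q + 1) ∣ V) (hV1 : coeff (q + 1) V = 1) :
    coeff (2 * q + 1) (flow V) = Polynomial.C (coeff (2 * q + 1) V) * Polynomial.X +
      Polynomial.C (((q : K) + 1) / 2) * Polynomial.X ^ 2 := by
  have hV2 : X ^ 2 ∣ V := (pow_dvd_pow X (by omega)).trans hV
  have hF := dvd_flow hV2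
  have hF1 : coeff 1 (flow V) = 1 := by
    rw [coeff_eq_of_dvd_sub (dvd_flow_sub_X hq hV) (by omega), coeff_one_X]
  refine coeff_flow_eq hV2 ?_ (by simp [coeff_X, show q ≠ 0 by omega])
  -- Splitting off the leading monomial leaves a field of order q + 2, whose feedback begins only in
  -- degree 2q+2.
  set W := V - X ^ (q + 1) with hW
  have hWd : X ^ (q + 1 + 1) ∣ W :=
    X_pow_dvd_of_coeff_eq_zero (dvd_sub hV dvd_rfl) (by rw [hW, map_sub, hV1]; simp)
  have key : ∀ U : (Polynomial K)⟦X⟧, X ∣ U →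
      (V.subst U : (Polynomial K)⟦X⟧) = U ^ (q + 1) + W.subst U := fun U hU => by
    have hs := HasSubst.of_X_dvd hU
    rw [hW, subst_sub hs, subst_pow hs, subst_X hs]; ring
  have h1 := coeff_eq_of_dvd_sub (X_pow_dvd_subst_sub hWd hF dvd_rfl
    (dvd_flow_sub_X hq hV)) (show 2 * q + 1 < q + 1 + (q + 1) by omega)
  have h2 := coeff_eq_of_dvd_sub (X_pow_dvd_pow_sub_pow_sub hF hF1 dvd_rfl coeff_one_X
    (dvd_flow_sub_X hq hV) q) (show 2 * q + 1 < q + 1 + q + 1 by omega)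
  rw [map_sub, map_sub, coeff_flow_of_lt hq hV (by omega), hV1, coeff_C_mul,
    show 2 * q + 1 = q + 1 + q by omega, coeff_X_pow_self] at h2
  have h3 : coeff (2 * q + 1) (V.subst (X : (Polynomial K)⟦X⟧)) =
      Polynomial.C (coeff (2 * q + 1) V) := by
    rw [← map_algebraMap_eq_subst_X, coeff_map]; simp
  rw [key X dvd_rfl, map_add] at h3
  rw [key _ hF, map_add (coeff _), h1]
  have hX : coeff (q + 1) (X : K⟦X⟧) = 0 := by rw [coeff_X, if_neg (by omega)]
  have hX' : coeff (q + 1) (X : (Polynomial K)⟦X⟧) = 0 := by rw [coeff_X, if_neg (by omega)]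
  rw [hX, hX', sub_eq_iff_eq_add] at h2
  rw [show 2 * q + 1 = q + 1 + q by omega] at h3 ⊢
  rw [h2]
  have h22 : (Polynomial.C 2 : Polynomial K) * Polynomial.C (((q : K) + 1) / 2) =
      (q : Polynomial K) + 1 := by
    rw [← map_mul, mul_div_cancel₀ _ two_ne_zero]; simp
  simp only [Polynomial.derivative_add, Polynomial.derivative_mul, Polynomial.derivative_C,
    Polynomial.derivative_X, Polynomial.derivative_X_pow, map_zero, map_one] at h22 ⊢
  push_cast
  linear_combination -h3 + Polynomial.X * h22

theorem dvd_modelField (q : ℕ) (μ : K) : X ^ (q + 1) ∣ modelField (q + 1) μ :=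
  Dvd.intro _ rfl

/-- In the geometric expansion the next term has degree 3q+1, which is at least 2q+2 because q ≥ 1.
-/
theorem modelField_dvd_sub {q : ℕ} (hq : 1 ≤ q) (μ : K) :
    X ^ (2 * q + 2) ∣ modelField (q + 1) μ -
      (X ^ (q + 1) + C (μ - ((q + 1 : ℕ) : K) / 2) * X ^ (2 * q + 1)) := by
  set ν := μ - ((q + 1 : ℕ) : K) / 2 with hν
  have h : (1 - C ν * X ^ q : K⟦X⟧)⁻¹ * (1 - C ν * X ^ q) = 1 :=
    PowerSeries.inv_mul_cancel _ (by simp [show q ≠ 0 by omega])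
  refine (pow_dvd_pow X (show 2 * q + 2 ≤ 3 * q + 1 by omega)).trans
    ⟨C ν ^ 2 * (1 - C ν * X ^ q : K⟦X⟧)⁻¹, ?_⟩
  rw [modelField, ← hν, Nat.add_sub_cancel]
  linear_combination (X ^ (q + 1) * (1 + C ν * X ^ q)) * h

theorem coeff_modelField {q : ℕ} (hq : 1 ≤ q) (μ : K) {e : ℕ} (he : e < 2 * q + 2) :
    coeff e (modelField (q + 1) μ) = (if e = q + 1 then 1 else 0) +
      (if e = 2 * q + 1 then μ - ((q + 1 : ℕ) : K) / 2 else 0) := by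
  rw [coeff_eq_of_dvd_sub (modelField_dvd_sub hq μ) he, map_add, coeff_C_mul, coeff_X_pow,
    coeff_X_pow, mul_ite, mul_one, mul_zero]

theorem hasLeadingTerm_timeMap [CharZero K] {q : ℕ} (hq : 1 ≤ q) (μ t : K) :
    HasLeadingTerm (timeMap (modelField (q + 1) μ) t) q t := by
  rw [HasLeadingTerm, X_pow_dvd_iff]
  intro e he
  rw [map_sub, timeMap, coeff_map, coeff_flow_of_lt hq (dvd_modelField q μ) (by omega),
    coeff_modelField hq μ (by omega), if_neg (show e ≠ 2 * q + 1 by omega)]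
  by_cases h : e = q + 1 <;> simp [coeff_X_pow, h]

/-- At t = 1 the coefficient in degree 2q+1 is (μ - (q+1)/2) + (q+1)/2 = μ. -/
theorem dvd_sub_timeMap_one [CharZero K] {q : ℕ} (hq : 1 ≤ q) (μ : K) :
    X ^ (2 * q + 2) ∣ (X + X ^ (q + 1) + C μ * X ^ (2 * q + 1)) -
      timeMap (modelField (q + 1) μ) 1 := by
  rw [X_pow_dvd_iff]
  intro e he
  rw [map_sub, timeMap, coeff_map]
  by_cases h : e = 2 * q + 1
  · rw [h, coeff_flow_two_mul_add_one hq (dvd_modelField q μ)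
      (by rw [coeff_modelField hq μ (by omega)]; simp [show q ≠ 0 by omega]),
      coeff_modelField hq μ (by omega), if_neg (by omega), if_pos rfl]
    have h1 : 2 * q + 1 ≠ q + 1 := by omega
    have h2 : q ≠ 0 := by omega
    simp [coeff_X_pow, coeff_X, h2]
  · rw [coeff_flow_of_lt hq (dvd_modelField q μ) (by omega),
      coeff_modelField hq μ (by omega), if_neg h]
    rw [map_add, map_add, coeff_C_mul, coeff_X_pow, coeff_X_pow, if_neg h]
    by_cases h' : e = q + 1 <;> simp [h']

end FlowLaws

open scoped Nat

/-! ### Analyticity as geometric growth of coefficients -/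

section Estimates

variable {K : Type*} [NontriviallyNormedField K]

theorem isLocallyAnalytic_of_bound {f : K⟦X⟧} {r B : ℝ} (hr : 0 < r)
    (h : ∀ n, ‖coeff n f‖ ≤ B * r ^ n) : IsLocallyAnalytic f := by
  have hr' : 0 < r.toNNReal⁻¹ := by simpa using hr
  refine lt_of_lt_of_le (ENNReal.coe_pos.mpr hr')
    (FormalMultilinearSeries.le_radius_of_bound _ B fun n => ?_)
  rw [FormalMultilinearSeries.ofScalars_norm, NNReal.coe_inv, Real.coe_toNNReal r hr.le, inv_pow]
  rw [← div_eq_mul_inv, div_le_iff₀ (pow_pos hr n)]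
  exact h n

theorem IsLocallyAnalytic.exists_bound {f : K⟦X⟧} (hf : IsLocallyAnalytic f) :
    ∃ B r : ℝ, 0 < B ∧ 0 < r ∧ ∀ n, ‖coeff n f‖ ≤ B * r ^ n := by
  obtain ⟨s, hs0, hs⟩ := ENNReal.lt_iff_exists_nnreal_btwn.mp hf
  have hs0' : 0 < s := ENNReal.coe_pos.mp hs0
  obtain ⟨B, hB, hb⟩ := FormalMultilinearSeries.norm_mul_pow_le_of_lt_radius _ hs
  refine ⟨B, (s : ℝ)⁻¹, hB, by simpa using hs0', fun n => ?_⟩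
  have := hb n
  rw [FormalMultilinearSeries.ofScalars_norm] at this
  rw [inv_pow, ← div_eq_mul_inv, le_div_iff₀ (by positivity)]
  exact this

/-- The bound on the linear coefficient lets the multiplicative constant be absorbed into R. For f =
x w the result reads |w_n| ≤ R^n, a condition stable under products in the ultrametric setting. -/
theorem IsLocallyAnalytic.exists_pow_bound {f : K⟦X⟧} (hf : IsLocallyAnalytic f)
    (hf1 : ‖coeff 1 f‖ ≤ 1) : ∃ R : ℝ, 1 ≤ R ∧ ∀ n, ‖coeff (n + 1) f‖ ≤ R ^ n := by
  obtain ⟨B, r, hB, hr, h⟩ := hf.exists_bound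
  refine ⟨max (B * r) 1 * max r 1, one_le_mul_of_one_le_of_one_le (le_max_right _ _)
    (le_max_right _ _), fun n => ?_⟩
  rcases n with _ | n
  · simpa using hf1
  · refine (h _).trans ?_
    rw [mul_pow, pow_succ' r, ← mul_assoc]
    refine mul_le_mul ((le_max_left _ _).trans (le_self_pow₀ (le_max_right _ _) (by omega)))
      (pow_le_pow_left₀ hr.le (le_max_left _ _) _) (by positivity) (by positivity)

theorem isLocallyAnalytic_of_pow_bound {f : K⟦X⟧} {R : ℝ} (hR : 1 ≤ R)
    (h : ∀ n, ‖coeff (n + 1) f‖ ≤ R ^ n) : IsLocallyAnalytic f := by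
  refine isLocallyAnalytic_of_bound (r := R) (B := max 1 ‖coeff 0 f‖) (by linarith) fun n => ?_
  rcases n with _ | n
  · simp
  · refine (h n).trans ((pow_le_pow_right₀ hR (Nat.le_succ n)).trans ?_)
    exact le_mul_of_one_le_left (by positivity) (le_max_left _ _)

theorem IsLocallyAnalytic.C_mul {f : K⟦X⟧} (hf : IsLocallyAnalytic f) (a : K) :
    IsLocallyAnalytic (C a * f) := by
  obtain ⟨B, r, hB, hr, h⟩ := hf.exists_bound
  refine isLocallyAnalytic_of_bound (B := ‖a‖ * B) hr fun n => ?_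
  rw [coeff_C_mul, norm_mul, mul_assoc]
  exact mul_le_mul_of_nonneg_left (h n) (norm_nonneg _)

theorem IsLocallyAnalytic.rescale {f : K⟦X⟧} (hf : IsLocallyAnalytic f) {a : K} (ha : a ≠ 0) :
    IsLocallyAnalytic (rescale a f) := by
  obtain ⟨B, r, hB, hr, h⟩ := hf.exists_bound
  refine isLocallyAnalytic_of_bound (B := B) (r := ‖a‖ * r)
    (mul_pos (norm_pos_iff.mpr ha) hr) fun n => ?_
  rw [coeff_rescale, norm_mul, norm_pow, mul_pow, mul_left_comm]
  exact mul_le_mul_of_nonneg_left (h n) (by positivity)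

theorem isLocallyAnalytic_modelField {q : ℕ} (hq : 1 ≤ q) (μ : K) :
    IsLocallyAnalytic (modelField (q + 1) μ) := by
  set ν := μ - ((q + 1 : ℕ) : K) / 2 with hν
  set I := (1 - C ν * X ^ q : K⟦X⟧)⁻¹ with hI
  have h : I * (1 - C ν * X ^ q) = 1 :=
    PowerSeries.inv_mul_cancel _ (by simp [show q ≠ 0 by omega])
  have hrec : I = 1 + C ν * (X ^ q * I) := by linear_combination h
  have hb : ∀ n, ‖coeff n I‖ ≤ max 1 ‖ν‖ ^ n := by
    intro n
    induction n using Nat.strong_induction_on with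
    | _ n ih =>
      rcases Nat.eq_zero_or_pos n with rfl | hn
      · rw [hrec]; simp [show q ≠ 0 by omega]
      · rw [hrec, map_add, coeff_C_mul, coeff_X_pow_mul', coeff_one, if_neg (by omega), zero_add]
        split_ifs with hqn
        · rw [norm_mul, show n = (n - 1) + 1 by omega, pow_succ']
          refine mul_le_mul (le_max_right _ _) ?_ (norm_nonneg _) (by positivity)
          refine (ih _ (by omega)).trans (pow_le_pow_right₀ (le_max_left _ _) (by omega))
        · simp only [mul_zero, norm_zero]; positivity
  refine isLocallyAnalytic_of_bound (B := 1) (r := max 1 ‖ν‖) (by positivity) fun n => ?_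
  rw [modelField, Nat.add_sub_cancel, ← hν, ← hI, coeff_X_pow_mul', one_mul]
  split_ifs with hn
  · exact (hb _).trans (pow_le_pow_right₀ (le_max_left _ _) (by omega))
  · simp only [norm_zero]; positivity

end Estimates

/-! ### Factorials and small divisors in an ultrametric field -/

section Ultrametric

variable {K : Type*} [NontriviallyNormedField K] [IsUltrametricDist K]

theorem norm_natCast_le_of_dvd {a b : ℕ} (h : a ∣ b) : ‖(b : K)‖ ≤ ‖(a : K)‖ := by
  obtain ⟨c, rfl⟩ := h
  rw [Nat.cast_mul, norm_mul]
  exact mul_le_of_le_one_right (norm_nonneg _) (IsUltrametricDist.norm_natCast_le_one K c)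

/-- The inverses of the factorials grow at most geometrically. -/
theorem exists_inv_norm_factorial_le [CharZero K] :
    ∃ B : ℝ, 1 ≤ B ∧ ∀ n : ℕ, ‖((n ! : ℕ) : K)‖⁻¹ ≤ B ^ n := by
  -- Either some prime p has norm less than 1, and |n!| is governed by the p-adic valuation of n!,
  -- or every nonzero natural number has norm 1.
  by_cases hp : ∃ p : ℕ, p.Prime ∧ ‖(p : K)‖ < 1
  · obtain ⟨p, hp, hp1⟩ := hp
    have hp0 : 0 < ‖(p : K)‖ := norm_pos_iff.mpr (Nat.cast_ne_zero.mpr hp.ne_zero)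
    have := Fact.mk hp
    refine ⟨‖(p : K)‖⁻¹, (one_le_inv₀ hp0).mpr hp1.le, fun n => ?_⟩
    obtain ⟨e, c, hc, he⟩ := Nat.exists_eq_pow_mul_and_not_dvd (n.factorial_ne_zero) p hp.ne_one
    have hen : e ≤ n := by
      have h1 : padicValNat p (n !) = e := by
        have hc0 : c ≠ 0 := fun h => hc (h ▸ dvd_zero p)
        rw [he, padicValNat.mul (pow_ne_zero _ hp.ne_zero) hc0, padicValNat.prime_pow,
          padicValNat.eq_zero_of_not_dvd hc, add_zero]
      -- Legendre's formula: (p-1) times the valuation of n! is n minus its digit sum, so the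
      -- valuation is at most n.
      have h2 := sub_one_mul_padicValNat_factorial (p := p) n
      have h3 := hp.two_le
      rw [h1] at h2
      have h4 : 1 * e ≤ (p - 1) * e := Nat.mul_le_mul_right _ (by omega)
      omega
    have hc1 : ‖(c : K)‖ = 1 := by
      refine le_antisymm (IsUltrametricDist.norm_natCast_le_one K c) ?_
      -- If |c| < 1 as well, a Bézout relation a p + b c = 1 would force |1| < 1.
      have hcop : IsCoprime (p : ℤ) (c : ℤ) :=
        Nat.isCoprime_iff_coprime.mpr ((Nat.Prime.coprime_iff_not_dvd hp).mpr hc)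
      obtain ⟨a, b, hab⟩ := hcop
      have hab' : (a : K) * p + (b : K) * c = 1 := by exact_mod_cast congrArg (Int.cast (R := K)) hab
      by_contra! hlt
      have h1 : ‖(a : K) * p‖ < 1 := by
        rw [norm_mul]
        exact (mul_le_of_le_one_left (norm_nonneg _)
          (IsUltrametricDist.norm_intCast_le_one K a)).trans_lt hp1
      have h2 : ‖(b : K) * c‖ < 1 := by
        rw [norm_mul]
        exact (mul_le_of_le_one_left (norm_nonneg _)
          (IsUltrametricDist.norm_intCast_le_one K b)).trans_lt hlt
      have h3 := (IsUltrametricDist.norm_add_le_max ((a : K) * p) ((b : K) * c)).trans_lt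
        (max_lt h1 h2)
      rw [hab', norm_one] at h3
      exact lt_irrefl _ h3
    rw [he, Nat.cast_mul, Nat.cast_pow, norm_mul, norm_pow, hc1, mul_one, ← inv_pow]
    exact pow_le_pow_right₀ ((one_le_inv₀ hp0).mpr hp1.le) hen
  · push Not at hp
    have key : ∀ n : ℕ, n ≠ 0 → ‖(n : K)‖ = 1 := by
      intro n
      induction n using Nat.recOnMul with
      | zero => simp
      | one => simp
      | prime p hp' =>
        intro _
        exact le_antisymm (IsUltrametricDist.norm_natCast_le_one K p) (hp p hp')
      | mul a b ha hb =>
        intro hab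
        rw [Nat.cast_mul, norm_mul, ha (left_ne_zero_of_mul hab), hb (right_ne_zero_of_mul hab),
          one_mul]
    exact ⟨1, le_rfl, fun n => by simp [key _ n.factorial_ne_zero]⟩

/-- Powers of a series whose coefficients lie in a multiplicative filtration. -/
theorem coeff_pow_mem {A : Type*} [CommRing A] (P : ℕ → AddSubmonoid A) (h1 : 1 ∈ P 0)
    (hmul : ∀ i j a b, a ∈ P i → b ∈ P j → a * b ∈ P (i + j)) {w : A⟦X⟧} {N : ℕ}
    (hw : ∀ n ≤ N, coeff n w ∈ P n) (k : ℕ) : ∀ n ≤ N, coeff n (w ^ k) ∈ P n := by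
  induction k with
  | zero =>
    intro n _
    rw [pow_zero, coeff_one]
    split_ifs with h
    · exact h ▸ h1
    · exact zero_mem _
  | succ k ih =>
    intro n hn
    rw [pow_succ, coeff_mul]
    refine sum_mem fun x hx => ?_
    rw [Finset.HasAntidiagonal.mem_antidiagonal] at hx
    rw [← hx]
    exact hmul _ _ _ _ (ih _ (by omega)) (hw _ (by omega))

/-- The closed ball of radius `r` as an additive monoid. -/
def ballSubmonoid (K : Type*) [NontriviallyNormedField K] [IsUltrametricDist K] (r : ℝ)
    (hr : 0 ≤ r) : AddSubmonoid K where
  carrier := {x | ‖x‖ ≤ r}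
  zero_mem' := by simpa using hr
  add_mem' ha hb := (IsUltrametricDist.norm_add_le_max _ _).trans (max_le ha hb)

theorem coeff_X_mul_pow_eq {A : Type*} [CommRing A] (w : A⟦X⟧) (d N : ℕ) :
    coeff N ((X * w) ^ d) = if d ≤ N then coeff (N - d) (w ^ d) else 0 := by
  rw [mul_pow, coeff_X_pow_mul']

theorem norm_coeff_pow_le {f : K⟦X⟧} (hf0 : X ∣ f) {R : ℝ} (hR : 1 ≤ R)
    (hf : ∀ n, ‖coeff (n + 1) f‖ ≤ R ^ n) (d N : ℕ) : ‖coeff N (f ^ d)‖ ≤ R ^ (N - d) := by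
  obtain ⟨w, rfl⟩ := hf0
  have hR0 : ∀ n, 0 ≤ R ^ n := fun n => by positivity
  simp only [coeff_succ_X_mul] at hf
  rw [coeff_X_mul_pow_eq]
  split_ifs with h
  · exact coeff_pow_mem (fun n => ballSubmonoid K (R ^ n) (hR0 n))
      (show ‖(1 : K)‖ ≤ R ^ 0 by simp)
      (fun i j a b ha hb => show ‖a * b‖ ≤ R ^ (i + j) by
        rw [norm_mul, pow_add]; exact mul_le_mul ha hb (norm_nonneg _) (hR0 _))
      (N := N - d) (fun n _ => hf n) d (N - d) le_rfl
  · simpa using hR0 _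

theorem sum_tsub_le_sum_sub_one {ι : Type*} (s : Finset ι) (l : ι → ℕ) {q : ℕ} (hq : 1 ≤ q) :
    ∑ i ∈ s, (l i - q) ≤ ∑ i ∈ s, l i - 1 := by
  classical
  induction s using Finset.induction_on with
  | empty => simp
  | insert a s ha ih => rw [Finset.sum_insert ha, Finset.sum_insert ha]; omega

/-- If some l_a exceeds q, it alone loses q. Either the other indices sum to zero and the bound on
l_a suffices, or truncation removes at least one more unit from them, which fits the total q + 1 +
p. -/
theorem sum_tsub_le {ι : Type*} (s : Finset ι) (l : ι → ℕ) {q p : ℕ} (hq : 1 ≤ q)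
    (hl : ∀ i ∈ s, l i ≤ q + p) (hs : ∑ i ∈ s, l i ≤ q + 1 + p) : ∑ i ∈ s, (l i - q) ≤ p := by
  classical
  by_cases h : ∃ a ∈ s, q < l a
  · obtain ⟨a, ha, haq⟩ := h
    have h1 := hl a ha
    have h2 := sum_tsub_le_sum_sub_one (s.erase a) l hq
    rw [← Finset.add_sum_erase s _ ha] at hs ⊢
    omega
  · push Not at h
    rw [Finset.sum_eq_zero fun i hi => Nat.sub_eq_zero_of_le (h i hi)]
    exact Nat.zero_le p

/-- The product of the small divisors met in a power of a series is controlled by a factorial. -/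
theorem norm_coeff_pow_mul_factorial_le {u : K⟦X⟧} (hu : X ∣ u) {q p : ℕ} (hq : 1 ≤ q) {S : ℝ}
    (hS : 1 ≤ S) (hb : ∀ k ≤ q + p, ‖coeff (k + 1) u‖ * ‖(((k - q) ! : ℕ) : K)‖ ≤ S ^ k)
    (h0 : ∀ k, q + p < k → coeff (k + 1) u = 0) {j : ℕ} (hj : q + 1 ≤ j) :
    ‖coeff (2 * q + 2 + p) (u ^ j)‖ * ‖((p ! : ℕ) : K)‖ ≤ S ^ (2 * q + 2 + p - j) := by
  classical
  obtain ⟨w, rfl⟩ := hu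
  simp only [coeff_succ_X_mul] at hb h0
  have hS0 : 0 ≤ S ^ (2 * q + 2 + p - j) := by positivity
  rw [coeff_X_mul_pow_eq]
  split_ifs with hjN
  swap
  · simpa using hS0
  rw [coeff_pow, ← norm_mul, Finset.sum_mul]
  refine IsUltrametricDist.norm_sum_le_of_forall_le_of_nonneg hS0 fun l hl => ?_
  rw [Finset.mem_finsuppAntidiag] at hl
  rw [norm_mul, norm_prod]
  by_cases hbig : ∃ i ∈ Finset.range j, q + p < l i
  · obtain ⟨i, hi, hil⟩ := hbig
    rw [Finset.prod_eq_zero hi (by rw [h0 _ hil, norm_zero]), zero_mul]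
    exact hS0
  · push Not at hbig
    have hsum := sum_tsub_le (Finset.range j) l hq hbig (by rw [hl.1]; omega)
    -- A single factor p! therefore pays for the denominators of all factors in the product, by
    -- divisibility of multinomial type.
    have hdvd : ∏ i ∈ Finset.range j, (l i - q)! ∣ p ! :=
      (Nat.prod_factorial_dvd_factorial_sum _ _).trans (Nat.factorial_dvd_factorial hsum)
    calc _ ≤ (∏ i ∈ Finset.range j, ‖coeff (l i) w‖) *
          ‖((∏ i ∈ Finset.range j, (l i - q)! : ℕ) : K)‖ := by
          gcongr ?_ * ?_
          exact norm_natCast_le_of_dvd hdvd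
      _ = ∏ i ∈ Finset.range j, (‖coeff (l i) w‖ * ‖(((l i - q)! : ℕ) : K)‖) := by
          rw [Nat.cast_prod, norm_prod, Finset.prod_mul_distrib]
      _ ≤ ∏ i ∈ Finset.range j, S ^ l i :=
          Finset.prod_le_prod (fun i _ => by positivity) fun i hi => hb _ (hbig i hi)
      _ = S ^ (2 * q + 2 + p - j) := by rw [Finset.prod_pow_eq_pow_sum, hl.1]

end Ultrametric

/-! ### Convergence of formal conjugacies -/

section MainEstimate

variable {K : Type*} [NontriviallyNormedField K] [IsUltrametricDist K]

/-- Strong induction on the recursion that gives the coefficient of x^(q+2+p) from the truncation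
`u`. The factorial weight absorbs the divisors p + 1, and `hRα` pays for the division by α. -/
theorem norm_conjugacy_coeff_le {f g h : K⟦X⟧} {q : ℕ} {α : K} (hα : α ≠ 0)
    (hf : HasLeadingTerm f q α) (hg : HasLeadingTerm g q α) (hq : 1 ≤ q) (hh : X ∣ h)
    (hh1 : coeff 1 h = 1) (hE : defect f g h = 0) {R S : ℝ} (hR : 1 ≤ R) (hRS : R ≤ S)
    (hRα : R ^ (q + 1) ≤ ‖α‖ * S) (hfb : ∀ n, ‖coeff (n + 1) f‖ ≤ R ^ n)
    (hgb : ∀ n, ‖coeff (n + 1) g‖ ≤ R ^ n) (hhb : ∀ k ≤ q, ‖coeff (k + 1) h‖ ≤ S ^ k) (k : ℕ) :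
    ‖coeff (k + 1) h‖ * ‖(((k - q) ! : ℕ) : K)‖ ≤ S ^ k := by
  have hS : 1 ≤ S := hR.trans hRS
  have hα0 : 0 < ‖α‖ := norm_pos_iff.mpr hα
  induction k using Nat.strong_induction_on with
  | _ k ih =>
  rcases Nat.lt_or_ge q k with hqk | hqk
  swap
  · rw [Nat.sub_eq_zero_of_le hqk]
    simpa using hhb k hqk
  obtain ⟨p, rfl⟩ : ∃ p, k = q + 1 + p := ⟨k - (q + 1), by omega⟩
  set u : K⟦X⟧ := PowerSeries.mk fun i => if i < q + 2 + p then coeff i h else 0 with hu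
  have hcu : ∀ i, coeff i u = if i < q + 2 + p then coeff i h else 0 := fun i => by
    rw [hu, coeff_mk]
  have hu0 : X ∣ u := by
    rw [X_dvd_iff, ← coeff_zero_eq_constantCoeff_apply, hcu, if_pos (by omega),
      coeff_zero_eq_constantCoeff_apply, X_dvd_iff.mp hh]
  have key := coeff_mul_eq_of_defect_eq_zero hf hg hq hh hh1 hE p hu
  have hub : ∀ k ≤ q + p, ‖coeff (k + 1) u‖ * ‖(((k - q) ! : ℕ) : K)‖ ≤ S ^ k := fun k hk => by
    rw [hcu, if_pos (by omega)]
    exact ih k (by omega)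
  have hu_big : ∀ k, q + p < k → coeff (k + 1) u = 0 := fun k hk => by
    rw [hcu, if_neg (by omega)]
  -- Apart from the α x^(q+1) part of g, the contributing terms carry at least q + 1 factors R;
  -- these are exchanged for |α| S.
  have aux : ∀ e k : ℕ, e + k = q + p → R ^ (q + 1 + e) * S ^ k ≤ ‖α‖ * S ^ (q + 1 + p) := by
    intro e k hek
    calc R ^ (q + 1 + e) * S ^ k = R ^ (q + 1) * (R ^ e * S ^ k) := by ring
      _ ≤ (‖α‖ * S) * (S ^ e * S ^ k) := by gcongr
      _ = ‖α‖ * S ^ (q + 1 + p) := by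
        rw [← pow_add, hek, mul_assoc, ← pow_succ', show q + p + 1 = q + 1 + p by omega]
  have hpos : 0 ≤ ‖α‖ * S ^ (q + 1 + p) := by positivity
  have hfacp : ∀ k ≤ q + p, ‖coeff (k + 1) u‖ * ‖((p ! : ℕ) : K)‖ ≤ S ^ k := fun k hk =>
    (mul_le_mul_of_nonneg_left (norm_natCast_le_of_dvd (Nat.factorial_dvd_factorial (by omega)))
      (norm_nonneg _)).trans (hub k hk)
  have hbound1 : ‖coeff (2 * q + 2 + p) (comp u f) * ((p ! : ℕ) : K)‖ ≤
      ‖α‖ * S ^ (q + 1 + p) := by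
    rw [comp, coeff_subst_eq_sum u hf.X_dvd (Nat.lt_succ_self _), Finset.sum_mul]
    refine IsUltrametricDist.norm_sum_le_of_forall_le_of_nonneg hpos fun d _ => ?_
    rcases d with _ | k
    · rw [coeff_zero_eq_constantCoeff_apply, X_dvd_iff.mp hu0]
      simpa using hpos
    by_cases hk : q + p < k
    · rw [hu_big k hk]
      simpa using hpos
    · rw [smul_eq_mul, mul_right_comm, norm_mul, norm_mul]
      calc _ ≤ S ^ k * R ^ (2 * q + 2 + p - (k + 1)) :=
            mul_le_mul (hfacp k (by omega)) (norm_coeff_pow_le hf.X_dvd hR hfb _ _)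
              (norm_nonneg _) (by positivity)
        _ = R ^ (q + 1 + (q + p - k)) * S ^ k := by
            rw [mul_comm, show 2 * q + 2 + p - (k + 1) = q + 1 + (q + p - k) by omega]
        _ ≤ _ := aux _ _ (by omega)
  have hbound2 : ‖coeff (2 * q + 2 + p) (comp g u) * ((p ! : ℕ) : K)‖ ≤
      ‖α‖ * S ^ (q + 1 + p) := by
    rw [comp, coeff_subst_eq_sum g hu0 (Nat.lt_succ_self _), Finset.sum_mul]
    refine IsUltrametricDist.norm_sum_le_of_forall_le_of_nonneg hpos fun d hd => ?_
    rw [Finset.mem_range] at hd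
    have hgd := coeff_eq_of_dvd_sub (k := d) hg
    rw [map_add, coeff_C_mul, coeff_X, coeff_X_pow] at hgd
    rw [smul_eq_mul, mul_assoc, norm_mul, norm_mul]
    rcases Nat.lt_or_ge d (q + 2) with hdq | hdq
    · rw [hgd hdq]
      by_cases hd1 : d = 1
      -- The linear term of g contributes nothing: `u` is truncated below degree q + 2 + p.
      · rw [hd1, pow_one, show 2 * q + 2 + p = 2 * q + 1 + p + 1 by omega,
          hu_big _ (by omega)]
        simpa using hpos
      · by_cases hdq' : d = q + 1
        -- Here the factor |α| is supplied by the coefficient of g itself.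
        · rw [if_neg hd1, if_pos hdq', hdq', mul_one, zero_add]
          have := norm_coeff_pow_mul_factorial_le hu0 hq hS hub hu_big (le_refl (q + 1))
          rw [show 2 * q + 2 + p - (q + 1) = q + 1 + p by omega] at this
          exact mul_le_mul_of_nonneg_left this (norm_nonneg _)
        · rw [if_neg hd1, if_neg hdq']
          simpa using hpos
    · obtain ⟨e, rfl⟩ : ∃ e, d = q + 2 + e := ⟨d - (q + 2), by omega⟩
      have h1 := norm_coeff_pow_mul_factorial_le hu0 hq hS hub hu_big
        (show q + 1 ≤ q + 2 + e by omega)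
      calc _ ≤ R ^ (q + 1 + e) * S ^ (2 * q + 2 + p - (q + 2 + e)) := by
            refine mul_le_mul ?_ h1 (by positivity) (by positivity)
            have := hgb (q + 1 + e)
            rwa [show q + 1 + e + 1 = q + 2 + e by omega] at this
        _ ≤ _ := ?_
      rcases Nat.lt_or_ge (q + p) e with he | he
      · omega
      · exact aux _ _ (by omega)
  have hbound : ‖coeff (2 * q + 2 + p) (defect f g u) * ((p ! : ℕ) : K)‖ ≤
      ‖α‖ * S ^ (q + 1 + p) := by
    rw [defect, map_sub, sub_mul, sub_eq_add_neg]
    rw [← norm_neg] at hbound2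
    exact (IsUltrametricDist.norm_add_le_max _ _).trans (max_le hbound1 hbound2)
  have hfac : (((q + 1 + p - q) ! : ℕ) : K) = ((p : K) + 1) * ((p ! : ℕ) : K) := by
    rw [show q + 1 + p - q = p + 1 by omega, Nat.factorial_succ]
    push_cast; ring
  rw [hfac, show q + 1 + p + 1 = q + 2 + p by omega]
  refine le_of_mul_le_mul_left ?_ hα0
  calc ‖α‖ * (‖coeff (q + 2 + p) h‖ * ‖((p : K) + 1) * ((p ! : ℕ) : K)‖)
      = ‖((p : K) + 1) * α * coeff (q + 2 + p) h * ((p ! : ℕ) : K)‖ := by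
        simp only [norm_mul]; ring
    _ = ‖coeff (2 * q + 2 + p) (defect f g u) * ((p ! : ℕ) : K)‖ := by
        rw [key, neg_mul, norm_neg]
    _ ≤ _ := hbound

/-- A formal conjugacy tangent to the identity between analytic germs is analytic. -/
theorem isLocallyAnalytic_of_defect_eq_zero [CharZero K] {f g h : K⟦X⟧} {q : ℕ} {α : K}
    (hα : α ≠ 0) (hf : HasLeadingTerm f q α) (hg : HasLeadingTerm g q α) (hq : 1 ≤ q)
    (hfa : IsLocallyAnalytic f) (hga : IsLocallyAnalytic g) (hh : X ∣ h)
    (hh1 : coeff 1 h = 1) (hE : defect f g h = 0) : IsLocallyAnalytic h := by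
  obtain ⟨R₁, hR₁, hfb⟩ := hfa.exists_pow_bound (by rw [hf.coeff_one hq, norm_one])
  obtain ⟨R₂, hR₂, hgb⟩ := hga.exists_pow_bound (by rw [hg.coeff_one hq, norm_one])
  obtain ⟨B, hB, hfac⟩ := exists_inv_norm_factorial_le (K := K)
  have hα0 : 0 < ‖α‖ := norm_pos_iff.mpr hα
  set R := max R₁ R₂
  have hR : 1 ≤ R := hR₁.trans (le_max_left _ _)
  -- The summands secure, in turn, R ≤ S, the cost of dividing by α, and the initial coefficients up
  -- to and including the free resonant one.
  set S := R + R ^ (q + 1) / ‖α‖ + ∑ k ∈ Finset.range (q + 1), ‖coeff (k + 1) h‖ with hS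
  have hq0 : 0 ≤ R ^ (q + 1) / ‖α‖ := by positivity
  have hs0 : 0 ≤ ∑ k ∈ Finset.range (q + 1), ‖coeff (k + 1) h‖ :=
    Finset.sum_nonneg fun _ _ => norm_nonneg _
  have hRS : R ≤ S := by linarith
  have hS1 : 1 ≤ S := hR.trans hRS
  have hRα : R ^ (q + 1) ≤ ‖α‖ * S := by
    rw [← div_le_iff₀' hα0]; linarith
  have hhb : ∀ k ≤ q, ‖coeff (k + 1) h‖ ≤ S ^ k := fun k hk => by
    rcases Nat.eq_zero_or_pos k with rfl | hk0
    · simp [hh1]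
    · have h1 := Finset.single_le_sum (f := fun k => ‖coeff (k + 1) h‖)
        (fun _ _ => norm_nonneg _) (Finset.mem_range.mpr (show k < q + 1 by omega))
      have h2 : ‖coeff (k + 1) h‖ ≤ S := by linarith
      exact h2.trans (le_self_pow₀ hS1 (by omega))
  refine isLocallyAnalytic_of_pow_bound (R := S * B) (one_le_mul_of_one_le_of_one_le hS1 hB)
    fun k => ?_
  have h1 := norm_conjugacy_coeff_le hα hf hg hq hh hh1 hE hR hRS hRα
    (fun n => (hfb n).trans (pow_le_pow_left₀ (by linarith) (le_max_left _ _) _))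
    (fun n => (hgb n).trans (pow_le_pow_left₀ (by linarith) (le_max_right _ _) _)) hhb k
  have h2 : 0 < ‖(((k - q) ! : ℕ) : K)‖ :=
    norm_pos_iff.mpr (Nat.cast_ne_zero.mpr (Nat.factorial_ne_zero _))
  rw [← le_div_iff₀ h2, div_eq_mul_inv] at h1
  refine h1.trans ?_
  rw [mul_pow]
  refine mul_le_mul_of_nonneg_left ?_ (by positivity)
  exact (hfac _).trans (pow_le_pow_right₀ hB (Nat.sub_le _ _))

end MainEstimate

/-! ### Convergence of the time maps -/

section FlowAnalytic

variable {K : Type*} [NontriviallyNormedField K] [IsUltrametricDist K]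

/-- Polynomials of degree at most `n` whose `i`-th derivative at `0` is bounded by `r`. -/
def derivBallSubmonoid (K : Type*) [NontriviallyNormedField K] [IsUltrametricDist K] (n : ℕ)
    (r : ℝ) (hr : 0 ≤ r) : AddSubmonoid (Polynomial K) where
  carrier := {p | ∀ i, ‖((i ! : ℕ) : K) * p.coeff i‖ ≤ r ∧ (n < i → p.coeff i = 0)}
  zero_mem' i := by simpa using hr
  add_mem' ha hb i := by
    refine ⟨?_, fun hi => ?_⟩
    · rw [Polynomial.coeff_add, mul_add]
      exact (IsUltrametricDist.norm_add_le_max _ _).trans (max_le (ha i).1 (hb i).1)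
    · rw [Polynomial.coeff_add, (ha i).2 hi, (hb i).2 hi, add_zero]

/-- By Leibniz' rule, i! times a coefficient of the product is a combination with binomial weights,
which are integers and so have norm at most 1. -/
theorem mul_mem_derivBallSubmonoid {m n : ℕ} {r s : ℝ} (hr : 0 ≤ r) (hs : 0 ≤ s)
    {a b : Polynomial K} (ha : a ∈ derivBallSubmonoid K m r hr)
    (hb : b ∈ derivBallSubmonoid K n s hs) :
    a * b ∈ derivBallSubmonoid K (m + n) (r * s) (mul_nonneg hr hs) := by
  intro i
  rw [Polynomial.coeff_mul]
  refine ⟨?_, fun hi => ?_⟩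
  · rw [Finset.mul_sum]
    refine IsUltrametricDist.norm_sum_le_of_forall_le_of_nonneg (mul_nonneg hr hs) fun x hx => ?_
    rw [Finset.HasAntidiagonal.mem_antidiagonal] at hx
    rw [← hx, ← Nat.add_choose_mul_factorial_mul_factorial]
    push_cast
    rw [show ((x.1 + x.2).choose x.2 : K) * (x.1 ! : ℕ) * (x.2 ! : ℕ) *
      (a.coeff x.1 * b.coeff x.2) = ((x.1 + x.2).choose x.2 : K) *
      (((x.1 ! : ℕ) * a.coeff x.1) * ((x.2 ! : ℕ) * b.coeff x.2)) by ring, norm_mul,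
      norm_mul (_ * _)]
    refine (mul_le_of_le_one_left (by positivity)
      (IsUltrametricDist.norm_natCast_le_one K _)).trans ?_
    exact mul_le_mul (ha _).1 (hb _).1 (norm_nonneg _) hr
  · refine Finset.sum_eq_zero fun x hx => ?_
    rw [Finset.HasAntidiagonal.mem_antidiagonal] at hx
    rcases Nat.lt_or_ge m x.1 with h | h
    · rw [(ha _).2 h, zero_mul]
    · rw [(hb _).2 (by omega), mul_zero]

theorem one_mem_derivBallSubmonoid :
    (1 : Polynomial K) ∈ derivBallSubmonoid K 0 1 zero_le_one := by
  intro i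
  rw [Polynomial.coeff_one]
  by_cases hi : i = 0
  · simp [hi]
  · simp [hi]

/-- Measuring polynomials by their derivatives at 0 makes integration in time free of denominators.
The factors V_d with d ≥ 2 leave time degree at most n - 1 in the velocity, hence n after
integration. -/
theorem coeff_flow_mem [CharZero K] {V : K⟦X⟧} (hV : X ^ 2 ∣ V) {R : ℝ} (hR : 1 ≤ R)
    (hVb : ∀ n, ‖coeff (n + 1) V‖ ≤ R ^ n) (n : ℕ) :
    coeff (n + 1) (flow V) ∈ derivBallSubmonoid K n (R ^ n) (by positivity) := by
  obtain ⟨-, hF0, hFd⟩ := isFormalFlow_flow hV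
  obtain ⟨w, hw⟩ := dvd_flow hV
  have hwc : ∀ n, coeff (n + 1) (flow V) = coeff n w := fun n => by rw [hw, coeff_succ_X_mul]
  induction n using Nat.strong_induction_on with
  | _ n ih =>
  have hval : (coeff (n + 1) (flow V)).coeff 0 = coeff (n + 1) (X : K⟦X⟧) := by
    rw [← hF0, Polynomial.coeff_zero_eq_eval_zero]; simp
  have hR0 : ∀ n, 0 ≤ R ^ n := fun n => by positivity
  have hder : ∀ i, ‖((i ! : ℕ) : K) *
      (Polynomial.derivative (coeff (n + 1) (flow V))).coeff i‖ ≤ R ^ n ∧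
      (n < i + 1 → (Polynomial.derivative (coeff (n + 1) (flow V))).coeff i = 0) := by
    have h1 : Polynomial.derivative (coeff (n + 1) (flow V)) =
        ∑ d ∈ Finset.range (n + 2), coeff d V • coeff (n + 1) (flow V ^ d) := by
      rw [← coeff_subst_eq_sum V (dvd_flow hV) (Nat.lt_succ_self _), ← hFd, timeDeriv, coeff_mk]
    have hterm : ∀ d ∈ Finset.range (n + 2), ∀ i,
        ‖((i ! : ℕ) : K) * (coeff d V • coeff (n + 1) (flow V ^ d)).coeff i‖ ≤ R ^ n ∧
        (n < i + 1 → (coeff d V • coeff (n + 1) (flow V ^ d)).coeff i = 0) := by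
      intro d hd i
      rw [Finset.mem_range] at hd
      by_cases hd2 : d < 2
      · rw [X_pow_dvd_iff.mp hV d hd2]
        simpa using hR0 n
      · obtain ⟨e, rfl⟩ : ∃ e, d = e + 2 := ⟨d - 2, by omega⟩
        have hmem := coeff_pow_mem (fun n => derivBallSubmonoid K n (R ^ n) (hR0 n))
          (by simpa using one_mem_derivBallSubmonoid)
          (fun i j a b ha hb => by
            have := mul_mem_derivBallSubmonoid _ _ ha hb
            simpa only [← pow_add] using this)
          (N := n + 1 - (e + 2)) (w := w)
          (fun k hk => by rw [← hwc]; exact ih k (by omega)) (e + 2) _ le_rfl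
        rw [hw, coeff_X_mul_pow_eq, if_pos (by omega), Polynomial.coeff_smul, smul_eq_mul]
        refine ⟨?_, fun hi => by rw [(hmem i).2 (by omega), mul_zero]⟩
        rw [mul_left_comm, norm_mul]
        calc _ ≤ R ^ (e + 1) * R ^ (n + 1 - (e + 2)) :=
              mul_le_mul (hVb (e + 1)) (hmem i).1 (norm_nonneg _) (hR0 _)
          _ = R ^ n := by rw [← pow_add]; congr 1; omega
    intro i
    rw [h1, Polynomial.finsetSum_coeff, Finset.mul_sum]
    exact ⟨IsUltrametricDist.norm_sum_le_of_forall_le_of_nonneg (hR0 n)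
      fun d hd => (hterm d hd i).1, fun hi => Finset.sum_eq_zero fun d hd => (hterm d hd i).2 hi⟩
  intro i
  rcases i with _ | i
  · refine ⟨?_, fun h => absurd h (Nat.not_lt_zero _)⟩
    rw [hval, coeff_X]
    split_ifs with h
    · simpa using one_le_pow₀ hR
    · simpa using hR0 n
  · have h := hder i
    rw [Polynomial.coeff_derivative] at h
    have hi0 : (i : K) + 1 ≠ 0 := by exact_mod_cast i.succ_ne_zero
    refine ⟨?_, fun hi => (mul_eq_zero.mp (h.2 hi)).resolve_right hi0⟩
    have e : (((i + 1)! : ℕ) : K) * (coeff (n + 1) (flow V)).coeff (i + 1) =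
        ((i ! : ℕ) : K) * ((coeff (n + 1) (flow V)).coeff (i + 1) * ((i : K) + 1)) := by
      rw [Nat.factorial_succ]; push_cast; ring
    rw [e]
    exact h.1

/-- Since the degree in t is at most n, both 1/|i!| and |t|^i grow at most geometrically in n; t
need not be small. -/
theorem isLocallyAnalytic_timeMap [CharZero K] {V : K⟦X⟧} (hV : X ^ 2 ∣ V)
    (hVa : IsLocallyAnalytic V) (t : K) : IsLocallyAnalytic (timeMap V t) := by
  obtain ⟨R, hR, hVb⟩ := hVa.exists_pow_bound (by
    rw [X_pow_dvd_iff.mp hV 1 (by omega), norm_zero]; exact zero_le_one)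
  obtain ⟨B, hB, hfac⟩ := exists_inv_norm_factorial_le (K := K)
  have hM : 1 ≤ max 1 ‖t‖ := le_max_left _ _
  refine isLocallyAnalytic_of_pow_bound (R := R * B * max 1 ‖t‖)
    (one_le_mul_of_one_le_of_one_le (one_le_mul_of_one_le_of_one_le hR hB) hM) fun n => ?_
  have hmem := coeff_flow_mem hV hR hVb n
  rw [timeMap, coeff_map, Polynomial.coe_evalRingHom, Polynomial.eval_eq_sum, Polynomial.sum_def]
  refine IsUltrametricDist.norm_sum_le_of_forall_le_of_nonneg (by positivity) fun i hi => ?_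
  have hin : i ≤ n := by
    by_contra! h
    exact (Polynomial.mem_support_iff.mp hi) ((hmem i).2 h)
  have h1 := (hmem i).1
  have h2 : 0 < ‖((i ! : ℕ) : K)‖ :=
    norm_pos_iff.mpr (Nat.cast_ne_zero.mpr (Nat.factorial_ne_zero _))
  rw [norm_mul, ← le_div_iff₀' h2, div_eq_mul_inv] at h1
  rw [norm_mul, norm_pow, mul_pow, mul_pow]
  refine mul_le_mul (h1.trans ?_) ?_ (by positivity) (by positivity)
  · exact mul_le_mul_of_nonneg_left ((hfac i).trans (pow_le_pow_right₀ hB hin)) (by positivity)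
  · exact (pow_le_pow_left₀ (norm_nonneg _) (le_max_right _ _) _).trans
      (pow_le_pow_right₀ hM hin)

end FlowAnalytic

/-! ### Reduction to tangent conjugacies; the formal centralizer -/

section Normalization

variable {K : Type*} [Field K]

theorem X_dvd_compInv (h : K⟦X⟧) (h1 : coeff 1 h ≠ 0) : X ∣ compInv h h1 :=
  X_dvd_iff.mpr (constantCoeff_substInvOfIsUnit h h1.isUnit)

theorem conj_eq_iff {h f g : K⟦X⟧} (h1 : coeff 1 h ≠ 0) (hh : X ∣ h) (hf : X ∣ f)
    (hg : X ∣ g) : conj h h1 f = g ↔ comp h f = comp g h := by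
  have hi := X_dvd_compInv h h1
  constructor
  · rintro rfl
    rw [conj, comp_assoc _ (X_dvd_comp hf hi) hh, comp_assoc _ hi hh,
      compInv_comp h (X_dvd_iff.mp hh) h1, comp_X]
  · intro e
    rw [conj, ← comp_assoc _ hf hi, e, comp_assoc _ hh hi,
      comp_compInv h (X_dvd_iff.mp hh) h1, comp_X]

theorem comp_left_injective {h u v : K⟦X⟧} (h1 : coeff 1 h ≠ 0) (hh : X ∣ h) (hu : X ∣ u)
    (hv : X ∣ v) (e : comp h u = comp h v) : u = v := by
  have := congrArg (comp (compInv h h1)) e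
  rwa [← comp_assoc _ hh hu, ← comp_assoc _ hh hv, compInv_comp h (X_dvd_iff.mp hh) h1,
    X_comp hu, X_comp hv] at this

/-- `C a⁻¹ * rescale a g` is x ↦ a⁻¹ g(a x), the conjugate of g by a dilation. -/
theorem comp_C_mul_rescale (g : K⟦X⟧) {h : K⟦X⟧} (hh : X ∣ h) {a : K} (ha : a ≠ 0) :
    comp (C a⁻¹ * rescale a g) (C a⁻¹ * h) = C a⁻¹ * comp g h := by
  have hh' : X ∣ C a⁻¹ * h := Dvd.dvd.mul_left hh _
  have hs := HasSubst.of_X_dvd hh'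
  have hX : (X : K⟦X⟧) ∣ a • X := by rw [smul_eq_C_mul]; exact Dvd.intro_left _ rfl
  have hC : (C a⁻¹).subst (C a⁻¹ * h) = C a⁻¹ := subst_C _
  have e : comp (a • X) (C a⁻¹ * h) = h := by
    rw [comp, subst_smul hs, subst_X hs, smul_eq_C_mul, ← mul_assoc, ← map_mul,
      mul_inv_cancel₀ ha, map_one, one_mul]
  rw [comp, subst_mul hs, hC, rescale_eq_subst]
  congr 1
  change comp (comp g (a • X)) _ = _
  rw [comp_assoc _ hX hh', e]

theorem C_mul_comp (a : K) (h : K⟦X⟧) {f : K⟦X⟧} (hf : X ∣ f) :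
    comp (C a * h) f = C a * comp h f := by
  have hC : (C a).subst f = C a := subst_C _
  rw [comp, subst_mul (HasSubst.of_X_dvd hf), hC, comp]

/-- Conjugacies can be normalized to be tangent to the identity. -/
theorem comp_eq_comp_normalize {f g h : K⟦X⟧} (hf : X ∣ f) (hh : X ∣ h) {a : K} (ha : a ≠ 0)
    (e : comp h f = comp g h) :
    comp (C a⁻¹ * h) f = comp (C a⁻¹ * rescale a g) (C a⁻¹ * h) := by
  rw [comp_C_mul_rescale g hh ha, C_mul_comp _ _ hf, e]

theorem HasLeadingTerm.normalize {g : K⟦X⟧} {q : ℕ} {β : K} (hg : HasLeadingTerm g q β) {a : K}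
    (ha : a ≠ 0) : HasLeadingTerm (C a⁻¹ * rescale a g) q (a ^ q * β) := by
  rw [HasLeadingTerm, X_pow_dvd_iff]
  intro e he
  have := X_pow_dvd_iff.mp hg e he
  rw [map_sub, sub_eq_zero, map_add, coeff_C_mul, coeff_X_pow, coeff_X] at this
  rw [map_sub, map_add, coeff_C_mul, coeff_C_mul, coeff_rescale, this, coeff_X_pow, coeff_X]
  split_ifs with h1 h2 h2
  · obtain rfl : q = 0 := by omega
    subst h1
    field_simp
    ring
  · subst h1
    field_simp
    ring
  · subst h2
    field_simp
    ring
  · ring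

/-- A germ tangent to the identity inherits the leading term of a germ to which it is conjugate
by a series tangent to the identity. -/
theorem HasLeadingTerm.of_comp_eq {f g h : K⟦X⟧} {q : ℕ} {β : K} (hg : HasLeadingTerm g q β)
    (hf : X ^ 2 ∣ f - X) (hh : X ^ 2 ∣ h - X) (e : comp h f = comp g h) :
    HasLeadingTerm f q β := by
  have hfX := X_dvd_of_dvd_sub_X hf
  have hhX := X_dvd_of_dvd_sub_X hh
  have hs := HasSubst.of_X_dvd hhX
  have hC : (C β).subst h = C β := subst_C _
  have h1 := X_pow_dvd_subst hg hhX
  rw [subst_sub hs, subst_add hs, subst_mul hs, subst_pow hs, subst_X hs, hC] at h1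
  have h2 : X ^ (q + 2) ∣ C β * (h ^ (q + 1) - X ^ (q + 1)) := by
    refine Dvd.dvd.mul_left ?_ _
    rw [add_comm q 2]
    exact X_pow_dvd_pow_sub_pow hhX dvd_rfl hh q
  have h3 : X ^ (q + 2) ∣ comp h f - h - C β * X ^ (q + 1) := by
    have := dvd_add h1 h2
    rw [e, comp]
    convert this using 1
    ring
  -- Bootstrapping: as h - x = O(x^2), replacing (h - x) ∘ f by h - x gains one order over the known
  -- congruence f ≡ x.
  have step : ∀ n, n ≤ q + 1 → X ^ n ∣ f - X → X ^ (n + 1) ∣ f - X - C β * X ^ (q + 1) := by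
    intro n hn hd
    have h4 := X_pow_dvd_subst_sub hh hfX dvd_rfl hd
    have hsf := HasSubst.of_X_dvd hfX
    rw [subst_sub hsf, subst_X hsf, X_subst] at h4
    have := dvd_sub ((pow_dvd_pow X (by omega)).trans h3) h4
    convert this using 1
    rw [comp]; ring
  have key : ∀ n, n ≤ q + 1 → X ^ n ∣ f - X := by
    intro n
    induction n with
    | zero => simp
    | succ n ih =>
      intro hn
      have h5 : (X : K⟦X⟧) ^ (n + 1) ∣ C β * X ^ (q + 1) :=
        Dvd.dvd.mul_left (pow_dvd_pow X hn) _
      have := dvd_add (step n (by omega) (ih (by omega))) h5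
      rwa [sub_add_cancel] at this
  have := step (q + 1) le_rfl (key _ le_rfl)
  rwa [sub_sub] at this

theorem TangentToId.dvd_sub_X {f : K⟦X⟧} (hf : TangentToId f) : X ^ 2 ∣ f - X := by
  refine X_pow_dvd_of_coeff_eq_zero (n := 1) ?_ (by rw [map_sub, hf.2, coeff_one_X, sub_self])
  rw [pow_one, X_dvd_iff, map_sub, hf.1, constantCoeff_X, sub_self]

theorem TangentToId.X_dvd {f : K⟦X⟧} (hf : TangentToId f) : X ∣ f := X_dvd_iff.mpr hf.1

/-- The leading term of a germ conjugate to a given one. -/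
theorem hasLeadingTerm_of_comp_eq {f g h : K⟦X⟧} {q : ℕ} {β : K} (hg : HasLeadingTerm g q β)
    (hf : TangentToId f) (hh : X ∣ h) (h1 : coeff 1 h ≠ 0)
    (e : comp h f = comp g h) : HasLeadingTerm f q (coeff 1 h ^ q * β) := by
  refine (hg.normalize h1).of_comp_eq hf.dvd_sub_X ?_ (comp_eq_comp_normalize hf.X_dvd hh h1 e)
  refine TangentToId.dvd_sub_X ⟨?_, ?_⟩
  · rw [map_mul, X_dvd_iff.mp hh, mul_zero]
  · rw [coeff_C_mul, inv_mul_cancel₀ h1]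

theorem hasLeadingTerm_normalForm {q : ℕ} (hq : 1 ≤ q) (μ : K) :
    HasLeadingTerm (X + X ^ (q + 1) + C μ * X ^ (2 * q + 1)) q 1 := by
  rw [HasLeadingTerm, map_one, one_mul, add_sub_cancel_left]
  exact Dvd.dvd.mul_left (pow_dvd_pow X (by omega)) _

/-- All exponents of the normal form are 1 modulo q, so it commutes with multiplication by a root of
a^q = 1. -/
theorem normalize_normalForm (q : ℕ) (μ : K) {a : K} (ha : a ≠ 0) (haq : a ^ q = 1) :
    C a⁻¹ * rescale a (X + X ^ (q + 1) + C μ * X ^ (2 * q + 1)) =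
      X + X ^ (q + 1) + C μ * X ^ (2 * q + 1) := by
  have hA : (C a⁻¹ * C a : K⟦X⟧) = 1 := by rw [← map_mul, inv_mul_cancel₀ ha, map_one]
  have hAq : (C a : K⟦X⟧) ^ q = 1 := by rw [← map_pow, haq, map_one]
  have hμ : rescale a (C μ) = C μ := by
    ext e
    rw [coeff_rescale, coeff_C]
    split_ifs with h <;> simp [h]
  rw [map_add, map_add, map_mul, map_pow, map_pow, rescale_X, hμ]
  linear_combination (X + C a ^ q * X ^ (q + 1) + C μ * C a ^ (2 * q) * X ^ (2 * q + 1)) * hA +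
    (X ^ (q + 1) + C μ * X ^ (2 * q + 1) * (C a ^ q + 1)) * hAq

/-- The formal conjugacy to the normal form, normalized whenever the leading coefficient is `1`. -/
theorem exists_comp_eq_normalForm {f : K⟦X⟧} (hf : TangentToId f) {q : ℕ} (hq : 1 ≤ q) {μ : K}
    (hinv : HasInvariants f (q + 1) μ) : ∃ H : K⟦X⟧, X ∣ H ∧ coeff 1 H ≠ 0 ∧
      (coeff (q + 1) f = 1 → coeff 1 H = 1) ∧
      comp H f = comp (X + X ^ (q + 1) + C μ * X ^ (2 * q + 1)) H := by
  obtain ⟨-, H, H1, H0, hc⟩ := hinv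
  rw [show 2 * (q + 1) - 1 = 2 * q + 1 by omega] at hc
  have hH := X_dvd_iff.mpr H0
  have hN := hasLeadingTerm_normalForm hq μ
  rw [conj_eq_iff H1 hH hf.X_dvd hN.X_dvd] at hc
  by_cases h : coeff (q + 1) f = 1
  · have haq : coeff 1 H ^ q = 1 := by
      have hlead := (hasLeadingTerm_of_comp_eq hN hf hH H1 hc).coeff_sub_X
      rw [map_sub, h, coeff_X, if_neg (by omega), sub_zero, mul_one] at hlead
      exact hlead.symm
    have h1 : coeff 1 (C (coeff 1 H)⁻¹ * H) = 1 := by rw [coeff_C_mul, inv_mul_cancel₀ H1]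
    refine ⟨C (coeff 1 H)⁻¹ * H, Dvd.dvd.mul_left hH _, by rw [h1]; exact one_ne_zero,
      fun _ => h1, ?_⟩
    have := comp_eq_comp_normalize hf.X_dvd hH H1 hc
    rwa [normalize_normalForm q μ H1 haq] at this
  · exact ⟨H, hH, H1, fun h' => absurd h' h, hc⟩

/-- The formal centralizer of a germ conjugate to a time-one map consists of the conjugates of the
time maps. -/
theorem formalCentralizer_eq [CharZero K] {f h : K⟦X⟧} {q : ℕ} (hq : 1 ≤ q) (μ : K) (hf : TangentToId f)
    (hh : X ∣ h) (h1 : coeff 1 h ≠ 0)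
    (e : comp h f = comp (timeMap (modelField (q + 1) μ) 1) h) :
    formalCentralizer f = {g | ∃ t : K,
      g = comp (compInv h h1) (comp (timeMap (modelField (q + 1) μ) t) h)} := by
  have hV := X_sq_dvd_modelField (show 2 ≤ q + 1 by omega) μ
  have hT : ∀ t, X ∣ timeMap (modelField (q + 1) μ) t := X_dvd_timeMap hV
  have hT1 : ∀ t, coeff 1 (timeMap (modelField (q + 1) μ) t) = 1 := fun t =>
    (hasLeadingTerm_timeMap hq μ t).coeff_one hq
  have hG := hasLeadingTerm_timeMap hq μ 1
  have hi := X_dvd_compInv h h1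
  have h0 := X_dvd_iff.mp hh
  have hi1 : coeff 1 h * coeff 1 (compInv h h1) = 1 := by
    rw [← coeff_one_comp hi, comp_compInv h h0 h1, coeff_one_X]
  ext g
  constructor
  · rintro ⟨hg, hgf⟩
    obtain ⟨k, hk⟩ : ∃ k, k = conj h h1 g := ⟨_, rfl⟩
    have hkX : X ∣ k := by rw [hk]; exact X_dvd_comp hh (X_dvd_comp hg.X_dvd hi)
    have hk1 : coeff 1 k = 1 := by
      rw [hk, conj, coeff_one_comp (X_dvd_comp hg.X_dvd hi), coeff_one_comp hi, hg.2, one_mul, hi1]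
    have hkh : comp h g = comp k h := (conj_eq_iff h1 hh hg.X_dvd hkX).mp hk.symm
    have hcomm : comp k (timeMap (modelField (q + 1) μ) 1) =
        comp (timeMap (modelField (q + 1) μ) 1) k := by
      have h2 : comp (comp k (timeMap (modelField (q + 1) μ) 1)) h =
          comp (comp (timeMap (modelField (q + 1) μ) 1) k) h := by
        rw [comp_assoc _ (hT 1) hh, ← e, ← comp_assoc _ hh hf.X_dvd, ← hkh,
          comp_assoc _ hg.X_dvd hf.X_dvd, hgf, comp_assoc _ hkX hh, ← hkh,
          ← comp_assoc _ hh hg.X_dvd, ← e, comp_assoc _ hf.X_dvd hg.X_dvd]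
      have h3 := congrArg (fun u => comp u (compInv h h1)) h2
      simpa only [comp_assoc _ hh hi, comp_compInv h h0 h1, comp_X] using h3
    -- Both sides conjugate T^1 to itself; taking the resonant coefficient of `k` as the time makes
    -- them agree at the only free coefficient.
    have hkT : k = timeMap (modelField (q + 1) μ) (coeff (q + 1) k) := by
      refine eq_of_defect_eq_zero one_ne_zero hG hG hq hkX hk1 (hT _) (hT1 _)
        (sub_eq_zero.mpr hcomm) (sub_eq_zero.mpr (comp_timeMap_comm hV _ _)) ?_
      have := (hasLeadingTerm_timeMap hq μ (coeff (q + 1) k)).coeff_sub_X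
      rw [map_sub, coeff_X, if_neg (by omega), sub_zero] at this
      exact this.symm
    refine ⟨coeff (q + 1) k, ?_⟩
    rw [← hkT, ← hkh, ← comp_assoc _ hh hg.X_dvd, compInv_comp h h0 h1, X_comp hg.X_dvd]
  · rintro ⟨t, rfl⟩
    have hTh := X_dvd_comp (hT t) hh
    have hgX := X_dvd_comp hi hTh
    refine ⟨⟨X_dvd_iff.mp hgX, ?_⟩, ?_⟩
    · rw [coeff_one_comp hTh, coeff_one_comp hh, hT1, one_mul, mul_comm, hi1]
    · have hkh : comp h (comp (compInv h h1) (comp (timeMap (modelField (q + 1) μ) t) h)) =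
          comp (timeMap (modelField (q + 1) μ) t) h := by
        rw [← comp_assoc _ hi hTh, comp_compInv h h0 h1, X_comp hTh]
      refine comp_left_injective h1 hh (X_dvd_comp hgX hf.X_dvd) (X_dvd_comp hf.X_dvd hgX) ?_
      rw [← comp_assoc _ hgX hf.X_dvd, hkh, comp_assoc _ hh hf.X_dvd, e,
        ← comp_assoc _ (hT 1) hh, ← comp_assoc _ hf.X_dvd hgX, e, comp_assoc _ hh hgX, hkh,
        ← comp_assoc _ (hT t) hh, comp_timeMap_comm hV]

end Normalization

/-! ### Analytic conjugacies and centralizers -/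

section Main

variable {K : Type*} [NontriviallyNormedField K] [IsUltrametricDist K] [CharZero K]

/-- A formal conjugacy between analytic germs tangent to the identity is analytic. -/
theorem isLocallyAnalytic_of_comp_eq {f g h : K⟦X⟧} {q : ℕ} {β : K} (hβ : β ≠ 0)
    (hg : HasLeadingTerm g q β) (hq : 1 ≤ q) (hf : TangentToId f) (hfa : IsLocallyAnalytic f)
    (hga : IsLocallyAnalytic g) (hh : X ∣ h) (h1 : coeff 1 h ≠ 0) (e : comp h f = comp g h) :
    IsLocallyAnalytic h := by
  have hk := isLocallyAnalytic_of_defect_eq_zero (mul_ne_zero (pow_ne_zero q h1) hβ)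
    (hasLeadingTerm_of_comp_eq hg hf hh h1 e) (hg.normalize h1) hq hfa
    ((hga.rescale h1).C_mul _) (Dvd.dvd.mul_left hh (C (coeff 1 h)⁻¹))
    (by rw [coeff_C_mul, inv_mul_cancel₀ h1])
    (sub_eq_zero.mpr (comp_eq_comp_normalize hf.X_dvd hh h1 e))
  have := hk.C_mul (coeff 1 h)
  rwa [← mul_assoc, ← map_mul, mul_inv_cancel₀ h1, map_one, one_mul] at this

/-- The formal centralizer of an analytic germ is analytic. -/
theorem formalCentralizer_eq_analyticCentralizer {f : K⟦X⟧} {q : ℕ} {α : K} (hα : α ≠ 0)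
    (hf : HasLeadingTerm f q α) (hq : 1 ≤ q) (hfa : IsLocallyAnalytic f) :
    formalCentralizer f = analyticCentralizer f := by
  ext g
  refine ⟨fun ⟨hg, e⟩ => ⟨?_, hg, e⟩, fun ⟨_, hg, e⟩ => ⟨hg, e⟩⟩
  exact isLocallyAnalytic_of_defect_eq_zero hα hf hf hq hfa hfa hg.X_dvd hg.2 (sub_eq_zero.mpr e)

end Main

end NonArchGerm

theorem mainTheorem4 {K : Type*} [NontriviallyNormedField K] [IsUltrametricDist K]
    [CompleteSpace K] [CharZero K] (f : PowerSeries K) (hf : NonArchGerm.IsLocallyAnalytic f)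
    (hf1 : NonArchGerm.TangentToId f) (m : ℕ) (μ : K) (hinv : NonArchGerm.HasInvariants f m μ) :
    (∃ (h : PowerSeries K) (h1 : PowerSeries.coeff 1 h ≠ 0),
      NonArchGerm.IsLocallyAnalytic h ∧ PowerSeries.constantCoeff h = 0 ∧
      (PowerSeries.coeff m f = 1 → NonArchGerm.TangentToId h) ∧
      NonArchGerm.conj h h1 f = NonArchGerm.timeMap (NonArchGerm.modelField m μ) 1) ∧
    ∀ (h : PowerSeries K) (h1 : PowerSeries.coeff 1 h ≠ 0),
      NonArchGerm.IsLocallyAnalytic h → PowerSeries.constantCoeff h = 0 →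
      NonArchGerm.conj h h1 f = NonArchGerm.timeMap (NonArchGerm.modelField m μ) 1 →
      NonArchGerm.analyticCentralizer f =
        {g | ∃ t : K, g = NonArchGerm.comp (NonArchGerm.compInv h h1)
          (NonArchGerm.comp (NonArchGerm.timeMap (NonArchGerm.modelField m μ) t) h)} ∧
      NonArchGerm.formalCentralizer f = NonArchGerm.analyticCentralizer f := by
  open NonArchGerm in
  obtain ⟨q, rfl⟩ : ∃ q, m = q + 1 := ⟨m - 1, by have := hinv.1; omega⟩
  have hq : 1 ≤ q := by have := hinv.1; omega
  have hV := X_sq_dvd_modelField hinv.1 μ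
  have hG := hasLeadingTerm_timeMap hq μ 1
  have hGa := isLocallyAnalytic_timeMap hV (isLocallyAnalytic_modelField hq μ) 1
  constructor
  · obtain ⟨H, hH, H1, Htan, hHf⟩ := exists_comp_eq_normalForm hf1 hq hinv
    have hN := hasLeadingTerm_normalForm hq μ
    -- `H` takes f to the polynomial normal form and `u` takes that to T^1. Both are only formal,
    -- but their composite joins analytic germs and is therefore analytic.
    obtain ⟨u, hu, huN⟩ := exists_comp_eq_comp hN hG hq (dvd_sub_timeMap_one hq μ)
    have hc1 : coeff 1 (comp u H) = coeff 1 H := by rw [coeff_one_comp hH, hu.2, one_mul]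
    have h1 : coeff 1 (comp u H) ≠ 0 := by rwa [hc1]
    have hX : X ∣ comp u H := X_dvd_comp hu.X_dvd hH
    have e : comp (comp u H) f = comp (timeMap (modelField (q + 1) μ) 1) (comp u H) := by
      rw [comp_assoc _ hH hf1.X_dvd, hHf, ← comp_assoc _ hN.X_dvd hH, huN,
        comp_assoc _ hu.X_dvd hH]
    exact ⟨comp u H, h1, isLocallyAnalytic_of_comp_eq one_ne_zero hG hq hf1 hf hGa hX h1 e,
      X_dvd_iff.mp hX, fun h => ⟨X_dvd_iff.mp hX, hc1.trans (Htan h)⟩,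
      (conj_eq_iff h1 hX hf1.X_dvd hG.X_dvd).mpr e⟩
  · intro h h1 _ h0 hc
    have hX := X_dvd_iff.mpr h0
    rw [conj_eq_iff h1 hX hf1.X_dvd hG.X_dvd] at hc
    have hZ := formalCentralizer_eq_analyticCentralizer
      (mul_ne_zero (pow_ne_zero q h1) one_ne_zero)
      (hasLeadingTerm_of_comp_eq hG hf1 hX h1 hc) hq hf
    exact ⟨hZ ▸ formalCentralizer_eq hq μ hf1 hX h1 hc, hZ⟩
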